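/- All digraphs are finite, without loops and without parallel arcs (two opposite arcs between a pair of vertices are allowed). A set of arcs is a \emph{matching} if no two of its arcs have a common end-vertex. A \emph{cover} of a digraph $D$ is a pair $(X,H)$ where $H$ is a digraph and $X$ assigns to each $v\in V(D)$ a set $X_v\subseteq V(H)$ such that the sets $X_v$ are pairwise disjoint with union $V(H)$, each $X_v$ is independent in $H$, for every arc $uv$ of $D$ the arcs of $H$ from $X_u$ to $X_v$ form a (possibly empty) matching $M_{uv}$, and $A(H)=\bigcup_{uv\in A(D)}M_{uv}$. A \emph{feasible configuration} is a triple $(D,X,H)$ where $D$ is a non-empty (weakly) connected digraph and $(X,H)$ is a cover of $D$. It is \emph{degree-feasible} if $|X_v|\ge\max\{d_D^+(v),d_D^-(v)\}$ for all $v\in V(D)$. It is \emph{colorable} if there is a set $T\subseteq V(H)$ with $|T\cap X_v|=1$ for all $v\in V(D)$ such that $H[T]$ contains no directed cycle (directed cycles have length at least $2$), and \emph{uncolorable} otherwise. It is \emph{minimal uncolorable} if it is uncolorable, but $(D,X,H-a)$ is colorable for every arc $a\in A(H)$. A feasible configuration $(D,X,H)$ is \begin{itemize} \item a \emph{K-configuration}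 if $D$ is a complete digraph (all arcs $uv$ with $u\neq v$) of order $n\ge 1$, $|X_v|=n-1$ for all $v$, and the elements of each $X_v$ can be labeled $x_v^1,\dots,x_v^{n-1}$ such that each $H^i=H[\{x_v^i : v\in V(D)\}]$ is a complete digraph and $H=H^1\cup\dots\cup H^{n-1}$; \item a \emph{C-configuration} if $D$ is a directed cycle of length $n\ge2$, $X_v=\{x_v\}$ for all $v$, and $A(H)=\{x_vx_u : vu\in A(D)\}$; \item an \emph{odd BC-configuration} if $D$ is a bidirected cycle (an undirected cycle with every edge replaced by two opposite arcs) of odd length $\ge5$, $|X_v|=2$ for all $v$, and the elements of each $X_v$ can be labeled $x_v^1,x_v^2$ such that $A(H)=\{x_v^ix_w^i : vw\in A(D),\ i\in\{1,2\}\}$; \item an \emph{even BC-configuration} if $D$ is a bidirected cycle of even length $\ge4$, $|X_v|=2$ for all $v$, and for some arc $uu'\in A(D)$ the elements of each $X_v$ can be labeled $x_v^1,x_v^2$ such that $A(H)=\{x_v^ix_w^i : vw\in A(D),\ \{v,w\}\ne\{u,u'\},\ i\in\{1,2\}\}\cup\{x_u^1x_{u'}^2,\ x_u^2x_{u'}^1,\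 x_{u'}^2x_u^1,\ x_{u'}^1x_u^2\}$. \end{itemize} Given feasible configurations $(D^1,X^1,H^1)$ and $(D^2,X^2,H^2)$ with $V(D^1)\cap V(D^2)=\varnothing=V(H^1)\cap V(H^2)$ and vertices $v^1\in V(D^1)$, $v^2\in V(D^2)$, \emph{merging} $v^1$ and $v^2$ to $v^*$ yields the feasible configuration $(D,X,H)$ in which $D$ arises from $D^1$ and $D^2$ by identifying $v^1$ and $v^2$ to a new vertex $v^*$, $H=H^1\cup H^2$, $X_{v^*}=X^1_{v^1}\cup X^2_{v^2}$, and $X_v=X^i_v$ for $v\in V(D^i)\setminus\{v^i\}$, $i\in\{1,2\}$. The class of \emph{constructible} configurations is the smallest class of feasible configurations (considered up to isomorphism) that contains all K-configurations, C-configurations and odd and even BC-configurations and is closed under merging. \textbf{Theorem.} Let $(D,X,H)$ be a degree-feasible (feasible) configuration. Then $(D,X,H)$ is minimal uncolorable if and only if $(D,X,H)$ is constructible. -/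

import Mathlib

universe u v

namespace DPColoring

/-- Out-degree `d⁺(a)`. -/
noncomputable def outDegree {V : Type u} (D : Digraph V) (a : V) : ℕ :=
  {b : V | D.Adj a b}.ncard

/-- In-degree `d⁻(a)`. -/
noncomputable def inDegree {V : Type u} (D : Digraph V) (a : V) : ℕ :=
  {b : V | D.Adj b a}.ncard

/-- `E_H(S, T)`: the arcs of `H` with initial vertex in `S` and terminal vertex in `T`. -/
def arcsBetween {W : Type v} (H : Digraph W) (S T : Set W) : Set (W × W) :=
  {a | a.1 ∈ S ∧ a.2 ∈ T ∧ H.Adj a.1 a.2}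

/-- A set of arcs is a matching if no two distinct arcs in it have a common end-vertex. -/
def IsMatching {W : Type v} (M : Set (W × W)) : Prop :=
  ∀ a ∈ M, ∀ b ∈ M, a ≠ b → a.1 ≠ b.1 ∧ a.1 ≠ b.2 ∧ a.2 ≠ b.1 ∧ a.2 ≠ b.2

/-- `(X, H)` is a cover of `D`, where the type `W` is the vertex set of `H`. -/
structure IsCover {V : Type u} {W : Type v} (D : Digraph V) (X : V → Set W) (H : Digraph W) :
    Prop where
  /-- The sets `X a` are pairwise disjoint. -/
  disjoint : ∀ a b, a ≠ b → Disjoint (X a) (X b)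
  /-- The vertex set of `H` is the union of the sets `X a`. -/
  union : ⋃ a, X a = Set.univ
  /-- Each `X a` is an independent set of `H`. -/
  independent : ∀ a, ∀ x ∈ X a, ∀ y ∈ X a, ¬ H.Adj x y
  /-- For every arc `ab` of `D`, the arcs of `H` from `X a` to `X b` form a matching. -/
  matching : ∀ a b, D.Adj a b → IsMatching (arcsBetween H (X a) (X b))
  /-- The arcs of `H` are exactly those in the matchings belonging to the arcs of `D`. -/
  arcs : ∀ x y, H.Adj x y ↔ ∃ a b, D.Adj a b ∧ (x, y) ∈ arcsBetween H (X a) (X b)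

/-- `T` meets every `X a` in exactly one vertex. -/
def IsTransversal {V : Type u} {W : Type v} (X : V → Set W) (T : Set W) : Prop :=
  ∀ a, ∃! x, x ∈ T ∩ X a

/-- The induced subdigraph `H[T]` contains a directed cycle (of some length `n ≥ 2`). -/
def HasDirectedCycleIn {W : Type v} (H : Digraph W) (T : Set W) : Prop :=
  ∃ n : ℕ, 2 ≤ n ∧ ∃ c : ZMod n → W, Function.Injective c ∧
    ∀ i, c i ∈ T ∧ H.Adj (c i) (c (i + 1))

/-- There is an acyclic transversal of `(X, H)`, that is, an `(X, H)`-coloring. -/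
def Colorable {V : Type u} {W : Type v} (X : V → Set W) (H : Digraph W) : Prop :=
  ∃ T : Set W, IsTransversal X T ∧ ¬ HasDirectedCycleIn H T

/-- `H - a` for the arc `a = xy`. -/
def deleteArc {W : Type v} (H : Digraph W) (x y : W) : Digraph W where
  Adj a b := H.Adj a b ∧ ¬ (a = x ∧ b = y)

/-- A feasible configuration `(D, X, H)`: a finite, loopless, (weakly) connected, non-empty
digraph `D` with vertex set `V`, together with a cover `(X, H)`, where `H` is a finite digraph
with vertex set `W`. -/
structure FeasibleConfig where
  V : Type u
  W : Type v
  finiteV : Finite V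
  finiteW : Finite W
  D : Digraph V
  X : V → Set W
  H : Digraph W
  loopless : ∀ a, ¬ D.Adj a a
  connected : D.toSimpleGraphInclusive.Connected
  cover : IsCover D X H

namespace FeasibleConfig

/-- `|X_a| ≥ max {d⁺(a), d⁻(a)}` for all vertices `a`. -/
def DegreeFeasible (C : FeasibleConfig.{u, v}) : Prop :=
  ∀ a, max (outDegree C.D a) (inDegree C.D a) ≤ (C.X a).ncard

/-- `(D, X, H)` is uncolorable, but deleting any arc of `H` makes it colorable. -/
def MinimalUncolorable (C : FeasibleConfig.{u, v}) : Prop :=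
  ¬ Colorable C.X C.H ∧ ∀ x y, C.H.Adj x y → Colorable C.X (deleteArc C.H x y)

end FeasibleConfig

/-- `D` is a complete digraph. -/
def IsCompleteDigraph {V : Type u} (D : Digraph V) : Prop :=
  ∀ a b, D.Adj a b ↔ a ≠ b

/-- `D` is a directed cycle of length `n` (used for `n ≥ 2`). -/
def IsDirectedCycle {V : Type u} (D : Digraph V) (n : ℕ) : Prop :=
  ∃ e : ZMod n ≃ V, ∀ i j, D.Adj (e i) (e j) ↔ j = i + 1

/-- `D` is a bidirected cycle of length `n` (used for `n ≥ 3`). -/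
def IsBidirectedCycle {V : Type u} (D : Digraph V) (n : ℕ) : Prop :=
  ∃ e : ZMod n ≃ V, ∀ i j, D.Adj (e i) (e j) ↔ (j = i + 1 ∨ i = j + 1)

/-- For each vertex `a`, `x a 0, …, x a (k - 1)` is a labeling of the elements of `X a`, without
repetition; in particular `|X_a| = k`. -/
def IsLabeling {V : Type u} {W : Type v} (X : V → Set W) (k : ℕ) (x : V → Fin k → W) : Prop :=
  ∀ a, Set.BijOn (x a) Set.univ (X a)

namespace FeasibleConfig

/-- K-configurations: `D` is complete of order `n ≥ 1`, and for some labelings of the sets `X_a`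
by `n - 1` labels, each `H^i = H[{x_a^i}]` is a complete digraph, and `H` is the union of the
`H^i`. -/
def IsK (C : FeasibleConfig.{u, v}) : Prop :=
  ∃ n : ℕ, 1 ≤ n ∧ Nat.card C.V = n ∧ IsCompleteDigraph C.D ∧
    ∃ x : C.V → Fin (n - 1) → C.W, IsLabeling C.X (n - 1) x ∧
      (∀ i a b, a ≠ b → C.H.Adj (x a i) (x b i)) ∧
      (∀ y z, C.H.Adj y z → ∃ i a b, y = x a i ∧ z = x b i)

/-- C-configurations: `D` is a directed cycle, `X_a = {x_a}`, and `H` is a copy of `D`. -/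
def IsC (C : FeasibleConfig.{u, v}) : Prop :=
  (∃ n : ℕ, 2 ≤ n ∧ IsDirectedCycle C.D n) ∧
    ∃ x : C.V → C.W, (∀ a, C.X a = {x a}) ∧
      ∀ y z, C.H.Adj y z ↔ ∃ a b, C.D.Adj a b ∧ y = x a ∧ z = x b

/-- Odd BC-configurations. -/
def IsOddBC (C : FeasibleConfig.{u, v}) : Prop :=
  (∃ n : ℕ, 5 ≤ n ∧ Odd n ∧ IsBidirectedCycle C.D n) ∧
    ∃ x : C.V → Fin 2 → C.W, IsLabeling C.X 2 x ∧
      ∀ y z, C.H.Adj y z ↔ ∃ a b i, C.D.Adj a b ∧ y = x a i ∧ z = x b i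

/-- Even BC-configurations: the matchings are straight except for those between `p` and `p'`,
which are crossed. -/
def IsEvenBC (C : FeasibleConfig.{u, v}) : Prop :=
  (∃ n : ℕ, 4 ≤ n ∧ Even n ∧ IsBidirectedCycle C.D n) ∧
    ∃ p p' : C.V, C.D.Adj p p' ∧ ∃ x : C.V → Fin 2 → C.W, IsLabeling C.X 2 x ∧
      ∀ y z, C.H.Adj y z ↔
        (∃ a b i, s(a, b) ≠ s(p, p') ∧ C.D.Adj a b ∧ y = x a i ∧ z = x b i) ∨
        (y = x p 0 ∧ z = x p' 1) ∨ (y = x p 1 ∧ z = x p' 0) ∨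
        (y = x p' 1 ∧ z = x p 0) ∨ (y = x p' 0 ∧ z = x p 1)

/-- `C` is obtained from disjoint copies of `C₁` and `C₂` (embedded by `f₁, g₁` and `f₂, g₂`) by
merging `v₁` and `v₂` to `w`: the copies of `D₁` and `D₂` cover `D` and share exactly the vertex
`w`, which is the image of `v₁` and of `v₂`; and `H` is the disjoint union of the copies of `H₁`
and `H₂`. -/
structure IsMerging (C₁ C₂ C : FeasibleConfig.{u, v}) (v₁ : C₁.V) (v₂ : C₂.V) (w : C.V)
    (f₁ : C₁.V ↪ C.V) (f₂ : C₂.V ↪ C.V) (g₁ : C₁.W ↪ C.W) (g₂ : C₂.W ↪ C.W) : Prop where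
  map_left : f₁ v₁ = w
  map_right : f₂ v₂ = w
  verts_union : Set.range f₁ ∪ Set.range f₂ = Set.univ
  verts_inter : Set.range f₁ ∩ Set.range f₂ = {w}
  arcs_iff : ∀ a b, C.D.Adj a b ↔
    (∃ a' b', C₁.D.Adj a' b' ∧ a = f₁ a' ∧ b = f₁ b') ∨
    (∃ a' b', C₂.D.Adj a' b' ∧ a = f₂ a' ∧ b = f₂ b')
  colors_union : Set.range g₁ ∪ Set.range g₂ = Set.univ
  colors_disjoint : Disjoint (Set.range g₁) (Set.range g₂)
  color_arcs_iff : ∀ x y, C.H.Adj x y ↔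
    (∃ x' y', C₁.H.Adj x' y' ∧ x = g₁ x' ∧ y = g₁ y') ∨
    (∃ x' y', C₂.H.Adj x' y' ∧ x = g₂ x' ∧ y = g₂ y')
  fiber_merged : C.X w = g₁ '' C₁.X v₁ ∪ g₂ '' C₂.X v₂
  fiber_left : ∀ a, a ≠ v₁ → C.X (f₁ a) = g₁ '' C₁.X a
  fiber_right : ∀ a, a ≠ v₂ → C.X (f₂ a) = g₂ '' C₂.X a

/-- The smallest class of feasible configurations that contains all K-, C- and BC-configurations
and is closed under merging. -/
inductive Constructible : FeasibleConfig.{u, v} → Prop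
  | ofK (C : FeasibleConfig.{u, v}) : C.IsK → Constructible C
  | ofC (C : FeasibleConfig.{u, v}) : C.IsC → Constructible C
  | ofOddBC (C : FeasibleConfig.{u, v}) : C.IsOddBC → Constructible C
  | ofEvenBC (C : FeasibleConfig.{u, v}) : C.IsEvenBC → Constructible C
  | merge (C₁ C₂ C : FeasibleConfig.{u, v}) (v₁ : C₁.V) (v₂ : C₂.V) (w : C.V)
      (f₁ : C₁.V ↪ C.V) (f₂ : C₂.V ↪ C.V) (g₁ : C₁.W ↪ C.W) (g₂ : C₂.W ↪ C.W) :
      Constructible C₁ → Constructible C₂ →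
      IsMerging C₁ C₂ C v₁ v₂ w f₁ f₂ g₁ g₂ → Constructible C

end FeasibleConfig

end DPColoring

namespace DPColoring

section Cyclic

variable {n : ℕ} [NeZero n]

theorem forall_mem_of_closed_succ {J : Set (ZMod n)} (h : ∀ i ∈ J, i + 1 ∈ J) {i : ZMod n}
    (hi : i ∈ J) (j : ZMod n) : j ∈ J := by
  have key : ∀ k : ℕ, i + (k : ZMod n) ∈ J := by
    intro k
    induction k with
    | zero => simpa using hi
    | succ k ih => rw [Nat.cast_succ, ← add_assoc]; exact h _ ih
  have := key (j - i).val
  rwa [ZMod.natCast_zmod_val, add_sub_cancel] at this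

theorem forall_mem_of_closed_pred {J : Set (ZMod n)} (h : ∀ i ∈ J, i - 1 ∈ J) {i : ZMod n}
    (hi : i ∈ J) (j : ZMod n) : j ∈ J := by
  have := forall_mem_of_closed_succ (J := {i | -i ∈ J})
    (fun i hi => by
      have := h _ hi
      simp only [Set.mem_ofPred_eq]
      rwa [neg_add, ← sub_eq_add_neg]) (i := -i) (by simpa using hi) (-j)
  simpa using this

/-- A nonempty set avoiding `m` that is closed under successor and predecessor, except for steps
onto `m`, is the complement of `m`. -/
theorem forall_ne_mem_of_closed {J : Set (ZMod n)} {m : ZMod n} (hm : m ∉ J)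
    (hs : ∀ i ∈ J, i + 1 ≠ m → i + 1 ∈ J) (hp : ∀ i ∈ J, i - 1 ≠ m → i - 1 ∈ J)
    {i : ZMod n} (hi : i ∈ J) {j : ZMod n} (hj : j ≠ m) : j ∈ J := by
  have h1 : m + 1 ∈ J := by
    by_contra h1
    refine hm (forall_mem_of_closed_pred (fun k hk => hp k hk ?_) hi m)
    rintro h
    rw [← h] at h1
    simp [hk] at h1
  have : j ∈ J ∪ {m} := by
    refine forall_mem_of_closed_succ (i := m) ?_ (by simp) j
    rintro k (hk | hk)
    · by_cases h : k + 1 = m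
      · simp [h]
      · exact Or.inl (hs k hk h)
    · rw [Set.mem_singleton_iff] at hk
      subst hk
      exact Or.inl h1
  rcases this with h | h
  · exact h
  · exact absurd h hj

end Cyclic

section Acyclic

variable {W : Type v} {H : Digraph W}

theorem HasDirectedCycleIn.mono {H' : Digraph W} {T T' : Set W} (h : HasDirectedCycleIn H T)
    (hT : T ⊆ T') (hH : ∀ x ∈ T, ∀ y ∈ T, H.Adj x y → H'.Adj x y) : HasDirectedCycleIn H' T' := by
  obtain ⟨n, hn, c, hc, h⟩ := h
  exact ⟨n, hn, c, hc, fun i => ⟨hT (h i).1, hH _ (h i).1 _ (h (i + 1)).1 (h i).2⟩⟩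

theorem HasDirectedCycleIn.subset {T T' : Set W} (h : HasDirectedCycleIn H T)
    (hT : T ⊆ T') : HasDirectedCycleIn H T' := h.mono hT fun _ _ _ _ h => h

theorem ne_succ {n : ℕ} (hn : 2 ≤ n) (i : ZMod n) : i + 1 ≠ i := by
  have : Fact (1 < n) := ⟨hn⟩
  simp

theorem ne_pred {n : ℕ} (hn : 2 ≤ n) (i : ZMod n) : i - 1 ≠ i := by
  have : Fact (1 < n) := ⟨hn⟩
  simp

end Acyclic

namespace FeasibleConfig

instance (C : FeasibleConfig.{u, v}) : Finite C.V := C.finiteV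
instance (C : FeasibleConfig.{u, v}) : Finite C.W := C.finiteW

variable (C : FeasibleConfig.{u, v})

theorem exists_mem_X (x : C.W) : ∃ a, x ∈ C.X a := by
  have : x ∈ ⋃ a, C.X a := by rw [C.cover.union]; trivial
  simpa using this

/-- The vertex of `D` to which a color belongs. -/
noncomputable def proj (x : C.W) : C.V := (C.exists_mem_X x).choose

theorem mem_X {x : C.W} {a : C.V} : x ∈ C.X a ↔ C.proj x = a := by
  have h := (C.exists_mem_X x).choose_spec
  constructor
  · intro hx
    by_contra hne
    exact Set.disjoint_left.1 (C.cover.disjoint _ _ hne) h hx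
  · rintro rfl
    exact h

variable {C}

theorem adj_proj {x y : C.W} (h : C.H.Adj x y) : C.D.Adj (C.proj x) (C.proj y) := by
  obtain ⟨a, b, hab, hx, hy, -⟩ := (C.cover.arcs x y).1 h
  rw [mem_X] at hx hy
  subst hx hy
  exact hab

theorem not_adj_self (x : C.W) : ¬ C.H.Adj x x := fun h => C.loopless _ (adj_proj h)

theorem proj_ne {x y : C.W} (h : C.H.Adj x y) : C.proj x ≠ C.proj y := by
  intro h'
  have := adj_proj h
  rw [h'] at this
  exact C.loopless _ this

theorem adj_right_unique {x y y' : C.W} (h : C.H.Adj x y) (h' : C.H.Adj x y')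
    (hp : C.proj y = C.proj y') : y = y' := by
  by_contra hne
  exact (C.cover.matching _ _ (adj_proj h) (x, y) ⟨C.mem_X.2 rfl, C.mem_X.2 rfl, h⟩ (x, y')
    ⟨C.mem_X.2 rfl, C.mem_X.2 hp.symm, h'⟩ (by simp [hne])).1 rfl

theorem adj_left_unique {x x' y : C.W} (h : C.H.Adj x y) (h' : C.H.Adj x' y)
    (hp : C.proj x = C.proj x') : x = x' := by
  by_contra hne
  exact (C.cover.matching _ _ (adj_proj h) (x, y) ⟨C.mem_X.2 rfl, C.mem_X.2 rfl, h⟩ (x', y)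
    ⟨C.mem_X.2 hp.symm, C.mem_X.2 rfl, h'⟩ (by simp [hne])).2.2.2 rfl

variable (C)

/-- Adjacency in the underlying graph of `D`. -/
def Nbr (a b : C.V) : Prop := C.D.Adj a b ∨ C.D.Adj b a

/-- The set `U` induces a connected (or empty) subdigraph of `D`. -/
def ConnOn (U : Set C.V) : Prop :=
  ∀ B ⊆ U, B.Nonempty → (U \ B).Nonempty → ∃ b ∈ B, ∃ a ∈ U \ B, C.Nbr b a

/-- `T` is a coloring of the subconfiguration induced by the vertex set `A`. -/
def PartialColoring (A : Set C.V) (T : Set C.W) : Prop :=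
  Set.BijOn C.proj T A ∧ ¬ HasDirectedCycleIn C.H T

variable {C}

theorem Nbr.symm {a b : C.V} (h : C.Nbr a b) : C.Nbr b a := Or.symm h

theorem Nbr.ne {a b : C.V} (h : C.Nbr a b) : a ≠ b := by
  rintro rfl
  rcases h with h | h <;> exact C.loopless _ h

theorem connOn_univ : C.ConnOn Set.univ := by
  rintro B - ⟨b, hb⟩ ⟨a, -, ha⟩
  obtain ⟨p⟩ := C.connected.preconnected b a
  obtain ⟨d, -, h1, h2⟩ := p.exists_boundary_dart B hb ha
  exact ⟨_, h1, _, ⟨trivial, h2⟩, d.adj.2⟩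

theorem isTransversal_iff {T : Set C.W} :
    IsTransversal C.X T ↔ Set.BijOn C.proj T Set.univ := by
  constructor
  · intro h
    refine ⟨fun _ _ => trivial, fun x hx y hy hxy => ?_, fun a _ => ?_⟩
    · exact (h (C.proj x)).unique ⟨hx, C.mem_X.2 rfl⟩ ⟨hy, C.mem_X.2 hxy.symm⟩
    · obtain ⟨x, hx, -⟩ := h a
      exact ⟨x, hx.1, C.mem_X.1 hx.2⟩
  · intro h a
    obtain ⟨x, hx, rfl⟩ := h.surjOn (Set.mem_univ a)
    exact ⟨x, ⟨hx, C.mem_X.2 rfl⟩, fun y hy => h.injOn hy.1 hx (C.mem_X.1 hy.2)⟩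

theorem colorable_iff : Colorable C.X C.H ↔ ∃ T, C.PartialColoring Set.univ T := by
  simp only [Colorable, isTransversal_iff, PartialColoring]

/-- Every directed cycle in `insert x T` passes through `x` if `T` is acyclic. -/
theorem mem_range_of_cycle {T : Set C.W} (hT : ¬ HasDirectedCycleIn C.H T) {x : C.W} {n : ℕ}
    (hn : 2 ≤ n) {c : ZMod n → C.W} (hc : Function.Injective c)
    (h : ∀ i, c i ∈ insert x T ∧ C.H.Adj (c i) (c (i + 1))) : x ∈ Set.range c := by
  by_contra hx
  refine hT ⟨n, hn, c, hc, fun i => ⟨?_, (h i).2⟩⟩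
  rcases (h i).1 with h' | h'
  · exact absurd ⟨i, h'⟩ hx
  · exact h'

theorem acyclic_insert {T : Set C.W} (hT : ¬ HasDirectedCycleIn C.H T) {x : C.W}
    (hx : (∀ t ∈ T, ¬ C.H.Adj x t) ∨ (∀ t ∈ T, ¬ C.H.Adj t x)) :
    ¬ HasDirectedCycleIn C.H (insert x T) := by
  rintro ⟨n, hn, c, hc, h⟩
  obtain ⟨i, hi⟩ := mem_range_of_cycle hT hn hc h
  rcases hx with hx | hx
  · have h1 := (h i).2
    rw [hi] at h1
    rcases (h (i + 1)).1 with h' | h'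
    · rw [h'] at h1; exact not_adj_self _ h1
    · exact hx _ h' h1
  · have h1 := (h (i - 1)).2
    rw [sub_add_cancel, hi] at h1
    rcases (h (i - 1)).1 with h' | h'
    · rw [h'] at h1; exact not_adj_self _ h1
    · exact hx _ h' h1

theorem bijOn_diff {A : Set C.V} {T : Set C.W} (h : Set.BijOn C.proj T A) {x : C.W}
    (hx : x ∈ T) : Set.BijOn C.proj (T \ {x}) (A \ {C.proj x}) := by
  refine ⟨fun y hy => ⟨h.mapsTo hy.1, fun hyx => hy.2 (h.injOn hy.1 hx hyx)⟩,
    h.injOn.mono Set.sdiff_subset, ?_⟩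
  rintro a ⟨ha, hax⟩
  obtain ⟨y, hy, rfl⟩ := h.surjOn ha
  exact ⟨y, ⟨hy, fun hyx => hax (by rw [Set.mem_singleton_iff.1 hyx]; rfl)⟩, rfl⟩

theorem PartialColoring.insert_color {A : Set C.V} {T : Set C.W} (h : C.PartialColoring A T)
    {x : C.W} (hxA : C.proj x ∉ A)
    (hx : (∀ t ∈ T, ¬ C.H.Adj x t) ∨ (∀ t ∈ T, ¬ C.H.Adj t x)) :
    C.PartialColoring (insert (C.proj x) A) (insert x T) :=
  ⟨h.1.insert hxA, acyclic_insert h.2 hx⟩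

theorem ncard_le_of_rel {R : C.W → C.W → Prop} {T : Set C.W} (hT : Set.InjOn C.proj T)
    (hR : ∀ x x' t, R x t → R x' t → C.proj x = C.proj x' → x = x') {v : C.V} {Y : Set C.W}
    (hY : ∀ x ∈ Y, C.proj x = v) {N : Set C.V} (h : ∀ x ∈ Y, ∃ t ∈ T, R x t ∧ C.proj t ∈ N) :
    Y.ncard ≤ N.ncard := by
  choose! f hfT hf hfN using h
  refine Set.ncard_le_ncard_of_injOn (fun x => C.proj (f x)) hfN ?_ N.toFinite
  intro x hx x' hx' hxx
  have := hT (hfT x hx) (hfT x' hx') hxx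
  have h1 := hf x hx
  rw [this] at h1
  exact hR _ _ _ h1 (hf x' hx') ((hY x hx).trans (hY x' hx').symm)

/-- A vertex with an uncolored neighbor has an available color. -/
theorem exists_available {A : Set C.V} {T : Set C.W} (h : C.PartialColoring A T) {a b : C.V}
    (hb : b ∉ A) (hab : C.Nbr a b) (hd : max (outDegree C.D a) (inDegree C.D a) ≤ (C.X a).ncard) :
    ∃ x, C.proj x = a ∧ ((∀ t ∈ T, ¬ C.H.Adj x t) ∨ (∀ t ∈ T, ¬ C.H.Adj t x)) := by
  by_contra! hcon
  rcases hab with hab | hab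
  · have := ncard_le_of_rel (R := C.H.Adj) (T := T) (v := a) (Y := C.X a)
      (N := {c | C.D.Adj a c} \ {b}) h.1.injOn (fun x x' t h1 h2 h3 => adj_left_unique h1 h2 h3)
      (fun x hx => C.mem_X.1 hx) (fun x hx => by
        obtain ⟨⟨t, ht, hxt⟩, -⟩ := hcon x (C.mem_X.1 hx)
        refine ⟨t, ht, hxt, ?_, ?_⟩
        · have := adj_proj hxt
          rwa [C.mem_X.1 hx] at this
        · rintro rfl
          exact hb (h.1.mapsTo ht))
    have h2 := Set.ncard_sdiff_singleton_lt_of_mem (s := {c | C.D.Adj a c}) (a := b) hab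
      (Set.toFinite _)
    have h3 := (le_max_left _ _).trans hd
    unfold outDegree at h3
    omega
  · have := ncard_le_of_rel (R := fun x y => C.H.Adj y x) (T := T) (v := a) (Y := C.X a)
      (N := {c | C.D.Adj c a} \ {b}) h.1.injOn (fun x x' t h1 h2 h3 => adj_right_unique h1 h2 h3)
      (fun x hx => C.mem_X.1 hx) (fun x hx => by
        obtain ⟨-, ⟨t, ht, hxt⟩⟩ := hcon x (C.mem_X.1 hx)
        refine ⟨t, ht, hxt, ?_, ?_⟩
        · have := adj_proj hxt
          rwa [C.mem_X.1 hx] at this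
        · rintro rfl
          exact hb (h.1.mapsTo ht))
    have h2 := Set.ncard_sdiff_singleton_lt_of_mem (s := {c | C.D.Adj c a}) (a := b) hab
      (Set.toFinite _)
    have h3 := (le_max_right _ _).trans hd
    unfold inDegree at h3
    omega

/-- Greedy coloring of a connected set of vertices towards the vertex `v`. -/
theorem exists_extension {U : Set C.V} {v : C.V} (hv : v ∈ U) (hU : C.ConnOn U)
    (hd : ∀ a ∈ U, a ≠ v → max (outDegree C.D a) (inDegree C.D a) ≤ (C.X a).ncard)
    {T : Set C.W} (hT : C.PartialColoring Uᶜ T) : ∃ T', T ⊆ T' ∧ C.PartialColoring {v}ᶜ T' := by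
  let P : Set C.V → Prop := fun B => v ∈ B ∧ B ⊆ U ∧
    ∀ T, C.PartialColoring Bᶜ T → ∃ T', T ⊆ T' ∧ C.PartialColoring {v}ᶜ T'
  have h0 : P {v} := ⟨rfl, by simpa using hv, fun T hT => ⟨T, subset_rfl, hT⟩⟩
  obtain ⟨B, -, hB⟩ := Finite.exists_le_maximal h0
  obtain ⟨hvB, hBU, hext⟩ := hB.prop
  by_cases hBU' : (U \ B).Nonempty
  · obtain ⟨b, hb, a, ha, hba⟩ := hU B hBU ⟨v, hvB⟩ hBU'
    have hP : P (insert a B) := by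
      refine ⟨Or.inr hvB, Set.insert_subset ha.1 hBU, fun T hT => ?_⟩
      obtain ⟨x, rfl, hx⟩ := exists_available hT (b := b) (by simp [hb]) hba.symm
        (hd a ha.1 (fun h => ha.2 (h ▸ hvB)))
      have h1 := hT.insert_color (by simp) hx
      have h2 : insert (C.proj x) (insert (C.proj x) B)ᶜ = Bᶜ := by
        ext z
        by_cases hz : z = C.proj x
        · simp [hz, ha.2]
        · simp [hz]
      rw [h2] at h1
      obtain ⟨T', hT', h3⟩ := hext _ h1
      exact ⟨T', (Set.subset_insert _ _).trans hT', h3⟩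
    exact absurd (hB.le_of_ge hP (Set.subset_insert _ _) (Set.mem_insert _ _)) ha.2
  · rw [Set.not_nonempty_iff_eq_empty, Set.sdiff_eq_empty] at hBU'
    rw [subset_antisymm hBU' hBU] at hT
    exact hext T hT

theorem bijOn_insert_hole {w : C.V} {T : Set C.W}
    (hT : C.PartialColoring {w}ᶜ T) {x : C.W} (hx : C.proj x = w) :
    Set.BijOn C.proj (insert x T) Set.univ := by
  have := hT.1.insert (a := x) (by simp [hx])
  rwa [hx, Set.insert_eq w, Set.union_compl_self] at this

section Hole

variable (hU : ¬ Colorable C.X C.H) {w : C.V} {T : Set C.W} (hT : C.PartialColoring {w}ᶜ T)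
include hU hT

theorem hasDirectedCycleIn_insert {x : C.W} (hx : C.proj x = w) :
    HasDirectedCycleIn C.H (insert x T) := by
  by_contra h
  exact hU (colorable_iff.2 ⟨_, bijOn_insert_hole hT hx, h⟩)

theorem exists_out {x : C.W} (hx : C.proj x = w) : ∃ t ∈ T, C.H.Adj x t := by
  by_contra! h
  exact acyclic_insert hT.2 (Or.inl h) (hasDirectedCycleIn_insert hU hT hx)

theorem exists_in {x : C.W} (hx : C.proj x = w) : ∃ t ∈ T, C.H.Adj t x := by
  by_contra! h
  exact acyclic_insert hT.2 (Or.inr h) (hasDirectedCycleIn_insert hU hT hx)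

theorem ncard_le_outDegree {N : Set C.V} (hN : {b | C.D.Adj w b} ⊆ N) :
    (C.X w).ncard ≤ N.ncard :=
  ncard_le_of_rel (R := C.H.Adj) (T := T) (v := w) (Y := C.X w) hT.1.injOn
    (fun _ _ _ h1 h2 h3 => adj_left_unique h1 h2 h3) (fun _ hx => C.mem_X.1 hx) (fun x hx => by
      obtain ⟨t, ht, hxt⟩ := exists_out hU hT (C.mem_X.1 hx)
      exact ⟨t, ht, hxt, hN (by have := adj_proj hxt; rwa [C.mem_X.1 hx] at this)⟩)

theorem ncard_le_inDegree {N : Set C.V} (hN : {b | C.D.Adj b w} ⊆ N) :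
    (C.X w).ncard ≤ N.ncard :=
  ncard_le_of_rel (R := fun x y => C.H.Adj y x) (T := T) (v := w) (Y := C.X w) hT.1.injOn
    (fun _ _ _ h1 h2 h3 => adj_right_unique h1 h2 h3) (fun _ hx => C.mem_X.1 hx) (fun x hx => by
      obtain ⟨t, ht, hxt⟩ := exists_in hU hT (C.mem_X.1 hx)
      exact ⟨t, ht, hxt, hN (by have := adj_proj hxt; rwa [C.mem_X.1 hx] at this)⟩)

variable (hd : C.DegreeFeasible)
include hd

theorem hole_out {t : C.W} (ht : t ∈ T) (hwt : C.D.Adj w (C.proj t)) :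
    ∃ x, C.proj x = w ∧ C.H.Adj x t ∧ ∀ s ∈ T, C.H.Adj x s → s = t := by
  have h1 : ∀ x ∈ C.X w, ∃ t ∈ T, C.H.Adj x t := fun x hx => exists_out hU hT (C.mem_X.1 hx)
  choose! f hfT hf using h1
  have hinj : Set.InjOn (fun x => C.proj (f x)) (C.X w) := by
    intro x hx x' hx' hxx
    have h2 := hT.1.injOn (hfT x hx) (hfT x' hx') hxx
    have h3 := hf x hx
    rw [h2] at h3
    exact adj_left_unique h3 (hf x' hx') ((C.mem_X.1 hx).trans (C.mem_X.1 hx').symm)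
  have hmaps : ∀ x ∈ C.X w, C.proj (f x) ∈ {b | C.D.Adj w b} := by
    intro x hx
    have := adj_proj (hf x hx)
    rwa [C.mem_X.1 hx] at this
  have himg : (fun x => C.proj (f x)) '' C.X w ⊆ {b | C.D.Adj w b} := by
    rintro _ ⟨x, hx, rfl⟩
    exact hmaps x hx
  have hsurj : {b | C.D.Adj w b} ⊆ (fun x => C.proj (f x)) '' C.X w := by
    refine (Set.eq_of_subset_of_ncard_le himg ?_).ge
    rw [hinj.ncard_image]
    exact (le_max_left _ _).trans (hd w)
  have hsurj' : ∀ s ∈ T, C.D.Adj w (C.proj s) → ∃ x ∈ C.X w, f x = s := by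
    intro s hs hws
    obtain ⟨x, hx, hxs⟩ := hsurj hws
    exact ⟨x, hx, hT.1.injOn (hfT x hx) hs hxs⟩
  obtain ⟨x, hx, rfl⟩ := hsurj' t ht hwt
  refine ⟨x, C.mem_X.1 hx, hf x hx, fun s hs hxs => ?_⟩
  obtain ⟨x', hx', rfl⟩ := hsurj' s hs (by have := adj_proj hxs; rwa [C.mem_X.1 hx] at this)
  rw [adj_left_unique hxs (hf x' hx') ((C.mem_X.1 hx).trans (C.mem_X.1 hx').symm)]

theorem hole_in {t : C.W} (ht : t ∈ T) (hwt : C.D.Adj (C.proj t) w) :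
    ∃ x, C.proj x = w ∧ C.H.Adj t x ∧ ∀ s ∈ T, C.H.Adj s x → s = t := by
  have h1 : ∀ x ∈ C.X w, ∃ t ∈ T, C.H.Adj t x := fun x hx => exists_in hU hT (C.mem_X.1 hx)
  choose! f hfT hf using h1
  have hinj : Set.InjOn (fun x => C.proj (f x)) (C.X w) := by
    intro x hx x' hx' hxx
    have h2 := hT.1.injOn (hfT x hx) (hfT x' hx') hxx
    have h3 := hf x hx
    rw [h2] at h3
    exact adj_right_unique h3 (hf x' hx') ((C.mem_X.1 hx).trans (C.mem_X.1 hx').symm)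
  have hmaps : ∀ x ∈ C.X w, C.proj (f x) ∈ {b | C.D.Adj b w} := by
    intro x hx
    have := adj_proj (hf x hx)
    rwa [C.mem_X.1 hx] at this
  have himg : (fun x => C.proj (f x)) '' C.X w ⊆ {b | C.D.Adj b w} := by
    rintro _ ⟨x, hx, rfl⟩
    exact hmaps x hx
  have hsurj : {b | C.D.Adj b w} ⊆ (fun x => C.proj (f x)) '' C.X w := by
    refine (Set.eq_of_subset_of_ncard_le himg ?_).ge
    rw [hinj.ncard_image]
    exact (le_max_right _ _).trans (hd w)
  have hsurj' : ∀ s ∈ T, C.D.Adj (C.proj s) w → ∃ x ∈ C.X w, f x = s := by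
    intro s hs hws
    obtain ⟨x, hx, hxs⟩ := hsurj hws
    exact ⟨x, hx, hT.1.injOn (hfT x hx) hs hxs⟩
  obtain ⟨x, hx, rfl⟩ := hsurj' t ht hwt
  refine ⟨x, C.mem_X.1 hx, hf x hx, fun s hs hxs => ?_⟩
  obtain ⟨x', hx', rfl⟩ := hsurj' s hs (by have := adj_proj hxs; rwa [C.mem_X.1 hx] at this)
  rw [adj_right_unique hxs (hf x' hx') ((C.mem_X.1 hx).trans (C.mem_X.1 hx').symm)]

theorem hole_out_unique {x s t : C.W} (hx : C.proj x = w) (hs : s ∈ T) (ht : t ∈ T)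
    (hxs : C.H.Adj x s) (hxt : C.H.Adj x t) : s = t := by
  obtain ⟨x', hx', hxt', h⟩ := hole_out hU hT hd ht (by have := adj_proj hxt; rwa [hx] at this)
  rw [← adj_left_unique hxt hxt' (hx.trans hx'.symm)] at h
  exact h s hs hxs

theorem hole_in_unique {x s t : C.W} (hx : C.proj x = w) (hs : s ∈ T) (ht : t ∈ T)
    (hxs : C.H.Adj s x) (hxt : C.H.Adj t x) : s = t := by
  obtain ⟨x', hx', hxt', h⟩ := hole_in hU hT hd ht (by have := adj_proj hxt; rwa [hx] at this)
  rw [← adj_right_unique hxt hxt' (hx.trans hx'.symm)] at h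
  exact h s hs hxs

end Hole

/-- `S` is a transversal and `c` is a directed cycle in `H[S]` meeting all directed cycles of
`H[S]` in all of its vertices. -/
structure NearColoring (C : FeasibleConfig.{u, v}) (S : Set C.W) (n : ℕ) (c : ZMod n → C.W) :
    Prop where
  bijOn : Set.BijOn C.proj S Set.univ
  two_le : 2 ≤ n
  inj : Function.Injective c
  mem : ∀ i, c i ∈ S
  adj : ∀ i, C.H.Adj (c i) (c (i + 1))
  acyclic : ∀ i, ¬ HasDirectedCycleIn C.H (S \ {c i})

namespace NearColoring

variable {S : Set C.W} {n : ℕ} {c : ZMod n → C.W}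

theorem neZero (h : C.NearColoring S n c) : NeZero n := ⟨by have := h.two_le; omega⟩

theorem adj_pred (h : C.NearColoring S n c) (i : ZMod n) : C.H.Adj (c (i - 1)) (c i) := by
  have := h.adj (i - 1)
  rwa [sub_add_cancel] at this

theorem hole (h : C.NearColoring S n c) (i : ZMod n) :
    C.PartialColoring {C.proj (c i)}ᶜ (S \ {c i}) := by
  have := bijOn_diff h.bijOn (h.mem i)
  rw [← Set.compl_eq_univ_sdiff] at this
  exact ⟨this, h.acyclic i⟩

theorem proj_inj (h : C.NearColoring S n c) {i j : ZMod n} (hij : C.proj (c i) = C.proj (c j)) :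
    i = j := h.inj (h.bijOn.injOn (h.mem i) (h.mem j) hij)

end NearColoring

theorem exists_nearColoring (hU : ¬ Colorable C.X C.H) (hd : C.DegreeFeasible) {w : C.V}
    {T : Set C.W} (hT : C.PartialColoring {w}ᶜ T) {x : C.W} (hx : C.proj x = w) :
    ∃ (n : ℕ) (c : ZMod n → C.W), C.NearColoring (insert x T) n c ∧ c 0 = x := by
  obtain ⟨n, hn, c, hc, h⟩ := hasDirectedCycleIn_insert hU hT hx
  obtain ⟨m, hm⟩ := mem_range_of_cycle hT.2 hn hc h
  have : NeZero n := ⟨by omega⟩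
  have hb := bijOn_insert_hole hT hx
  have hxT : x ∉ T := fun h' => by
    have := hT.1.mapsTo h'
    simp [hx] at this
  have h0 : m ∈ {i | ¬ HasDirectedCycleIn C.H (insert x T \ {c i})} := by
    rw [Set.mem_ofPred_eq, hm, Set.insert_sdiff_of_mem _ (Set.mem_singleton x), Set.sdiff_singleton_eq_self hxT]
    exact hT.2
  have hac := forall_mem_of_closed_succ (fun i (hi : ¬ HasDirectedCycleIn C.H _) => by
    rintro ⟨k, hk, d, hdi, hdd⟩
    by_cases hci : c i ∈ Set.range d
    · obtain ⟨j, hj⟩ := hci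
      have hh : C.PartialColoring {C.proj (c i)}ᶜ (insert x T \ {c i}) := by
        have := bijOn_diff hb (h i).1
        rw [← Set.compl_eq_univ_sdiff] at this
        exact ⟨this, hi⟩
      have h1 := (hdd j).2
      rw [hj] at h1
      have h2 := hole_out_unique hU hh hd rfl (s := d (j + 1)) (t := c (i + 1))
        ⟨(hdd _).1.1, fun h3 => by
          rw [Set.mem_singleton_iff, ← hj] at h3
          exact ne_succ hk _ (hdi h3)⟩
        ⟨(h _).1, fun h3 => ne_succ hn _ (hc h3)⟩ h1 (h i).2
      exact (hdd (j + 1)).1.2 h2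
    · refine hi ⟨k, hk, d, hdi, fun l => ⟨⟨(hdd l).1.1, fun h3 => hci ⟨l, h3⟩⟩, (hdd l).2⟩⟩) h0
  refine ⟨n, fun i => c (i + m), ⟨hb, hn, fun i j hij => add_right_cancel (hc hij),
    fun i => (h _).1, fun i => ?_, fun i => hac _⟩, by simpa using hm⟩
  rw [add_right_comm]
  exact (h _).2

namespace NearColoring

variable {S : Set C.W} {n : ℕ} {c : ZMod n → C.W}
variable (hU : ¬ Colorable C.X C.H) (hd : C.DegreeFeasible) (h : C.NearColoring S n c)
include hU hd h

theorem out_unique {i : ZMod n} {s : C.W} (hs : s ∈ S) (his : C.H.Adj (c i) s) :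
    s = c (i + 1) :=
  hole_out_unique hU (h.hole i) hd rfl
    ⟨hs, fun h' => by rw [Set.mem_singleton_iff.1 h'] at his; exact not_adj_self _ his⟩
    ⟨h.mem _, fun h' => ne_succ h.two_le _ (h.inj h')⟩ his (h.adj i)

theorem in_unique {i : ZMod n} {s : C.W} (hs : s ∈ S) (his : C.H.Adj s (c i)) :
    s = c (i - 1) :=
  hole_in_unique hU (h.hole i) hd rfl
    ⟨hs, fun h' => by rw [Set.mem_singleton_iff.1 h'] at his; exact not_adj_self _ his⟩
    ⟨h.mem _, fun h' => ne_pred h.two_le _ (h.inj h')⟩ his (h.adj_pred i)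

/-- The vertices of the cycle of a near-coloring induce a directed cycle in `D`. -/
theorem induced {i j : ZMod n} (hij : C.D.Adj (C.proj (c i)) (C.proj (c j))) : j = i + 1 := by
  have := h.neZero
  by_contra hne
  have hji : j ≠ i := by
    rintro rfl
    exact C.loopless _ hij
  obtain ⟨z, hz, hzj, -⟩ := hole_out hU (h.hole i) hd (t := c j)
    ⟨h.mem j, fun h' => hji (h.inj h')⟩ hij
  have hzi : z ≠ c i := by
    rintro rfl
    exact hne (h.inj (h.out_unique hU hd (h.mem j) hzj))
  obtain ⟨m, d, hd', hd0⟩ := exists_nearColoring hU hd (h.hole i) hz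
  have hj : c j ∈ Set.range d := by
    rw [← hd0] at hzj
    exact ⟨_, (hd'.out_unique hU hd (Or.inr ⟨h.mem j, fun h' => hji (h.inj h')⟩) hzj).symm⟩
  have hmemd : ∀ s ∈ Set.range d, s = z ∨ (s ∈ S ∧ s ≠ c i) := by
    rintro _ ⟨l, rfl⟩
    exact hd'.mem l
  have hci : c i ∉ Set.range d := by
    intro hci
    rcases hmemd _ hci with h' | h'
    · exact hzi h'.symm
    · exact h'.2 rfl
  have hi1 : c (i + 1) ∈ Set.range d := by
    by_contra hi1
    have := forall_mem_of_closed_pred (J := {k | c k ∈ Set.range d}) (fun k hk => by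
      obtain ⟨l, hl⟩ := id hk
      have hk1 : k - 1 ≠ i := by
        rintro rfl
        rw [sub_add_cancel] at hi1
        exact hi1 hk
      have h1 := h.adj_pred k
      rw [← hl] at h1
      exact ⟨_, (hd'.in_unique hU hd
        (Or.inr ⟨h.mem _, fun h' => hk1 (h.inj h')⟩) h1).symm⟩) hj i
    exact hci this
  obtain ⟨l, hl⟩ := hi1
  have h1 := hd'.adj_pred l
  rw [hl] at h1
  have h2 : d (l - 1) = c i := by
    rcases hmemd _ ⟨l - 1, rfl⟩ with h' | h'
    · rw [h'] at h1 ⊢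
      exact adj_left_unique h1 (h.adj i) hz
    · rw [h.in_unique hU hd h'.1 h1, add_sub_cancel_right]
  exact hci ⟨_, h2⟩

end NearColoring

section Shift

variable (hU : ¬ Colorable C.X C.H) (hd : C.DegreeFeasible)
include hU hd

theorem mem_range_of_adj {T : Set C.W} {x t : C.W} {n : ℕ} {c : ZMod n → C.W}
    (h : C.NearColoring (insert x T) n c) (hc : c 0 = x) (ht : t ∈ T)
    (hxt : C.H.Adj x t ∨ C.H.Adj t x) : t ∈ Set.range c := by
  rw [← hc] at hxt
  rcases hxt with hxt | hxt
  · exact ⟨_, (h.out_unique hU hd (Or.inr ht) hxt).symm⟩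
  · exact ⟨_, (h.in_unique hU hd (Or.inr ht) hxt).symm⟩

/-- Shifting the uncolored vertex `w` to the vertex of a color `t` conflicting with `x`. -/
theorem PartialColoring.shift {w : C.V} {T : Set C.W} (hT : C.PartialColoring {w}ᶜ T)
    {x t : C.W} (hx : C.proj x = w) (ht : t ∈ T) (hxt : C.H.Adj x t ∨ C.H.Adj t x) :
    C.PartialColoring {C.proj t}ᶜ (insert x T \ {t}) := by
  obtain ⟨n, c, h, hc⟩ := exists_nearColoring hU hd hT hx
  obtain ⟨i, rfl⟩ := mem_range_of_adj hU hd h hc ht hxt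
  exact h.hole i

/-- If `a` is a neighbor of the uncolored vertex `w`, its color conflicts with a color of `w`. -/
theorem exists_conflict {w : C.V} {T : Set C.W} (hT : C.PartialColoring {w}ᶜ T) {t : C.W}
    (ht : t ∈ T) (hwt : C.Nbr w (C.proj t)) :
    ∃ x, C.proj x = w ∧ (C.H.Adj x t ∨ C.H.Adj t x) := by
  rcases hwt with h | h
  · obtain ⟨x, hx, hxt, -⟩ := hole_out hU hT hd ht h
    exact ⟨x, hx, Or.inl hxt⟩
  · obtain ⟨x, hx, hxt, -⟩ := hole_in hU hT hd ht h
    exact ⟨x, hx, Or.inr hxt⟩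

end Shift

/-- `T` colors all vertices but `w`, contains `P`, and no arc of `H[T]` leaves or enters `P`. -/
structure Isolates (C : FeasibleConfig.{u, v}) (P : Set C.W) (w : C.V) (T : Set C.W) :
    Prop where
  hole : C.PartialColoring {w}ᶜ T
  subset : P ⊆ T
  closed : ∀ p ∈ P, ∀ t ∈ T, (C.H.Adj p t ∨ C.H.Adj t p) → t ∈ P

namespace Isolates

variable (hU : ¬ Colorable C.X C.H) (hd : C.DegreeFeasible)
variable {P : Set C.W} {w : C.V} {T : Set C.W} (h : C.Isolates P w T)
include h

theorem proj_ne {p : C.W} (hp : p ∈ P) : C.proj p ≠ w := fun h' =>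
  h.hole.1.mapsTo (h.subset hp) h'

theorem cycle_mem {x : C.W} (hx : C.proj x = w) {n : ℕ} {c : ZMod n → C.W}
    (hc : C.NearColoring (insert x T) n c) (hc0 : c 0 = x) {k : ZMod n} (hk : c k ∈ P)
    {j : ZMod n} (hj : j ≠ 0) : c j ∈ P := by
  have := hc.neZero
  have hmem : ∀ i, i ≠ 0 → c i ∈ T := fun i hi => (hc.mem i).resolve_left fun h' =>
    hi (hc.inj (h'.trans hc0.symm))
  exact forall_ne_mem_of_closed (J := {i | c i ∈ P}) (m := 0)
    (fun h' => h.proj_ne h' (by rw [hc0, hx]))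
    (fun i hi hi0 => h.closed _ hi _ (hmem _ hi0) (Or.inl (hc.adj i)))
    (fun i hi hi0 => h.closed _ hi _ (hmem _ hi0) (Or.inr (hc.adj_pred i))) hk hj

include hU hd

theorem step {a : C.V} (hwa : C.Nbr w a) (ha : ∀ p ∈ P, C.proj p ≠ a) :
    ∃ T', C.Isolates P a T' := by
  obtain ⟨t, ht, rfl⟩ := h.hole.1.surjOn (Set.mem_compl_singleton_iff.2 hwa.ne.symm)
  obtain ⟨x, hx, hxt⟩ := exists_conflict hU hd h.hole ht hwa
  obtain ⟨n, c, hc, hc0⟩ := exists_nearColoring hU hd h.hole hx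
  obtain ⟨i, hi⟩ := mem_range_of_adj hU hd hc hc0 ht hxt
  have htP : t ∉ P := fun h' => ha t h' rfl
  have hdis : ∀ k, c k ∉ P := fun k hk => by
    refine htP (hi ▸ h.cycle_mem hx hc hc0 hk ?_)
    rintro rfl
    rw [hc0] at hi
    rw [hi] at hx
    exact hwa.ne hx.symm
  refine ⟨_, h.hole.shift hU hd hx ht hxt, fun p hp => ⟨Or.inr (h.subset hp), ?_⟩, ?_⟩
  · rintro rfl
    exact htP hp
  · rintro p hp s ⟨rfl | hs, -⟩ hps
    · rw [← hc0] at hps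
      exfalso
      rcases hps with hps | hps
      · exact hdis _ (hc.in_unique hU hd (Or.inr (h.subset hp)) hps ▸ hp)
      · exact hdis _ (hc.out_unique hU hd (Or.inr (h.subset hp)) hps ▸ hp)
    · exact h.closed p hp s hs hps

/-- The cycle of a near-coloring minus a color `c i` cannot be isolated with an uncolored vertex
that is a neighbor of it other than that of `c i`. -/
theorem absurd_of_nbr {S : Set C.W} {n : ℕ} {c : ZMod n → C.W} (hc : C.NearColoring S n c)
    (hn : 3 ≤ n) {i k : ZMod n} (hP : P = c '' {i}ᶜ) (hwi : w ≠ C.proj (c i))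
    (hk : k ≠ i) (hwk : C.Nbr w (C.proj (c k))) : False := by
  have := hc.neZero
  have hPc : ∀ k, k ≠ i → c k ∈ P := fun k hk => by rw [hP]; exact ⟨k, hk, rfl⟩
  have hPi : ∀ p ∈ P, C.proj p ≠ C.proj (c i) := by
    rw [hP]
    rintro _ ⟨k, hk, rfl⟩ h'
    exact hk (hc.proj_inj h')
  obtain ⟨x, hx, hxk⟩ := exists_conflict hU hd h.hole (h.subset (hPc k hk)) hwk
  obtain ⟨m, d, hd', hd0⟩ := exists_nearColoring hU hd h.hole hx
  obtain ⟨l, hl⟩ := mem_range_of_adj hU hd hd' hd0 (h.subset (hPc k hk)) hxk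
  have hdP : ∀ j, j ≠ 0 → d j ∈ P := fun j hj =>
    h.cycle_mem hx hd' hd0 (k := l) (hl ▸ hPc k hk) hj
  have hdi : ∀ s, C.proj s = C.proj (c i) → s ∉ Set.range d := by
    rintro s hs ⟨j, rfl⟩
    by_cases hj : j = 0
    · rw [hj, hd0, hx] at hs
      exact hwi hs
    · exact hPi _ (hdP j hj) hs
  have hcd : ∀ j, j ≠ i → c j ∈ Set.range d := fun j hj => by
    refine forall_ne_mem_of_closed (J := {j | c j ∈ Set.range d}) (m := i) (hdi _ rfl) ?_ ?_
      (i := k) ⟨l, hl⟩ hj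
    · rintro j ⟨q, hq⟩ hji
      have h1 := hc.adj j
      rw [← hq] at h1
      exact ⟨_, (hd'.out_unique hU hd (Or.inr (h.subset (hPc _ hji))) h1).symm⟩
    · rintro j ⟨q, hq⟩ hji
      have h1 := hc.adj_pred j
      rw [← hq] at h1
      exact ⟨_, (hd'.in_unique hU hd (Or.inr (h.subset (hPc _ hji))) h1).symm⟩
  obtain ⟨s, hs, hsi⟩ := h.hole.1.surjOn (Set.mem_compl_singleton_iff.2 hwi.symm)
  obtain ⟨a, ha⟩ := hcd (i + 1) (ne_succ hc.two_le i)
  obtain ⟨b, hb⟩ := hcd (i - 1) (ne_pred hc.two_le i)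
  have hsd := hdi s hsi
  have hmem : ∀ j, s ∈ insert x T \ {d j} := fun j =>
    ⟨Or.inr hs, fun h' => hsd ⟨j, (Set.mem_singleton_iff.1 h').symm⟩⟩
  obtain ⟨y, hy, hsy, -⟩ := hole_in hU (hd'.hole a) hd (hmem a)
    (by rw [hsi, ha]; exact adj_proj (hc.adj i))
  obtain ⟨y', hy', hsy', -⟩ := hole_out hU (hd'.hole b) hd (hmem b)
    (by rw [hsi, hb]; exact adj_proj (hc.adj_pred i))
  obtain ⟨m₁, d₁, hd₁, hd₁0⟩ := exists_nearColoring hU hd (hd'.hole a) hy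
  obtain ⟨m₂, d₂, hd₂, hd₂0⟩ := exists_nearColoring hU hd (hd'.hole b) hy'
  have hno : ∀ e ∈ insert x T, ¬ C.H.Adj e s := by
    intro e he hes
    by_cases heb : e = d b
    · rw [heb] at hes
      exact hsd ⟨_, (hd'.out_unique hU hd (Or.inr hs) hes).symm⟩
    · have h1 : s = d₂ (0 + 1) := hd₂.out_unique hU hd (Or.inr (hmem b)) (by rwa [hd₂0])
      rw [h1] at hes
      have h2 := hd₂.in_unique hU hd (Or.inr ⟨he, heb⟩) hes
      rw [add_sub_cancel_right, hd₂0] at h2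
      have h3 := (hd'.hole b).1.mapsTo (⟨he, heb⟩ : e ∈ insert x T \ {d b})
      rw [h2] at h3
      exact h3 hy'
  have h1 : s = d₁ (0 - 1) := hd₁.in_unique hU hd (Or.inr (hmem a)) (by rwa [hd₁0])
  have h2 := hd₁.adj_pred (0 - 1)
  rw [← h1] at h2
  rcases hd₁.mem (0 - 1 - 1) with h3 | h3
  · rw [h3] at h2
    have h4 := adj_proj h2
    rw [hy, hsi, ha] at h4
    have h5 := hc.induced hU hd h4
    have h6 : ((2 : ℕ) : ZMod n) = 0 := by
      have : i + 2 = i := by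
        rw [← one_add_one_eq_two, ← add_assoc]
        exact h5.symm
      simpa using this
    rw [ZMod.natCast_eq_zero_iff] at h6
    have := Nat.le_of_dvd (by norm_num) h6
    omega
  · exact hno _ h3.1 h2

end Isolates

section Block

variable (hU : ¬ Colorable C.X C.H) (hd : C.DegreeFeasible)
  (hB : ∀ w, C.ConnOn {w}ᶜ)
include hU hd

include hB in
/-- In a block, a near-coloring with a cycle of length at least three is spanned by the cycle. -/
theorem NearColoring.spanning {S : Set C.W} {n : ℕ} {c : ZMod n → C.W}
    (hc : C.NearColoring S n c) (hn : 3 ≤ n) (a : C.V) : ∃ i, C.proj (c i) = a := by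
  have := hc.neZero
  by_contra ha
  obtain ⟨_, ⟨i, rfl⟩, b, ⟨-, hb⟩, hib⟩ := connOn_univ (C := C)
    (Set.range fun i => C.proj (c i)) (Set.subset_univ _) ⟨_, 0, rfl⟩ ⟨a, trivial, ha⟩
  have hPb : ∀ b, (∀ p ∈ c '' {i}ᶜ, C.proj p ≠ b) ∨ ∃ k, k ≠ i ∧ C.proj (c k) = b := by
    intro b
    by_contra! h
    obtain ⟨⟨_, ⟨k, hk, rfl⟩, hp⟩, h⟩ := h
    exact h k hk hp
  have h0 : C.Isolates (c '' {i}ᶜ) (C.proj (c i)) (S \ {c i}) := by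
    refine ⟨hc.hole i, ?_, ?_⟩
    · rintro _ ⟨k, hk, rfl⟩
      exact ⟨hc.mem k, fun h => hk (hc.inj h)⟩
    · rintro _ ⟨k, hk, rfl⟩ t ⟨ht, hti⟩ (h | h)
      · rw [hc.out_unique hU hd ht h] at hti ⊢
        exact ⟨k + 1, fun h' => hti (by rw [Set.mem_singleton_iff.1 h']; rfl), rfl⟩
      · rw [hc.in_unique hU hd ht h] at hti ⊢
        exact ⟨k - 1, fun h' => hti (by rw [Set.mem_singleton_iff.1 h']; rfl), rfl⟩
  obtain ⟨b', ⟨hb'1, T, hT⟩, a', ⟨ha'1, ha'⟩, hba⟩ := hB (C.proj (c i))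
    ({w | w ≠ C.proj (c i) ∧ ∃ T, C.Isolates (c '' {i}ᶜ) w T}) (fun w hw => hw.1)
    ⟨b, fun h => hb ⟨i, h.symm⟩, h0.step hU hd hib ((hPb b).resolve_right
      fun ⟨k, _, hk⟩ => hb ⟨k, hk⟩)⟩
    ⟨C.proj (c (i + 1)), fun h => ne_succ hc.two_le i (hc.proj_inj h), fun h => by
      obtain ⟨-, T, hT⟩ := h
      exact hT.proj_ne (p := c (i + 1)) ⟨i + 1, ne_succ hc.two_le i, rfl⟩ rfl⟩
  rcases hPb a' with h | ⟨k, hk, rfl⟩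
  · exact ha' ⟨ha'1, hT.step hU hd hba h⟩
  · exact hT.absurd_of_nbr hU hd hc hn rfl hb'1 hk hba

theorem NearColoring.isC {S : Set C.W} {n : ℕ} {c : ZMod n → C.W}
    (hc : C.NearColoring S n c) (hs : ∀ a, ∃ i, C.proj (c i) = a) : C.IsC := by
  let e : ZMod n ≃ C.V := Equiv.ofBijective (fun i => C.proj (c i))
    ⟨fun i j h => hc.proj_inj h, hs⟩
  have he : ∀ i, e i = C.proj (c i) := fun i => rfl
  have hD : ∀ i j, C.D.Adj (e i) (e j) ↔ j = i + 1 := fun i j =>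
    ⟨hc.induced hU hd, by rintro rfl; exact adj_proj (hc.adj i)⟩
  have huniq : ∀ i z, C.proj z = C.proj (c i) → z = c i := by
    intro i z hz
    obtain ⟨t, ht, hzt⟩ := exists_out hU (hc.hole i) hz
    obtain ⟨j, hj⟩ := hs (C.proj t)
    have h1 := hc.bijOn.injOn (hc.mem j) ht.1 hj
    have h2 := adj_proj hzt
    rw [hz, ← h1] at h2
    rw [← h1, hc.induced hU hd h2] at hzt
    exact adj_left_unique hzt (hc.adj i) hz
  have hproj : ∀ z, c (e.symm (C.proj z)) = z := fun z =>
    (huniq _ _ (by rw [← he, e.apply_symm_apply])).symm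
  refine ⟨⟨n, hc.two_le, e, hD⟩, fun a => c (e.symm a), fun a => ?_, fun y z => ⟨fun h => ?_, ?_⟩⟩
  · ext z
    rw [C.mem_X, Set.mem_singleton_iff]
    constructor
    · rintro rfl
      exact (hproj z).symm
    · rintro rfl
      rw [← he, e.apply_symm_apply]
  · exact ⟨_, _, adj_proj h, (hproj y).symm, (hproj z).symm⟩
  · rintro ⟨a, b, hab, rfl, rfl⟩
    have h1 := (hD (e.symm a) (e.symm b)).1 (by simpa using hab)
    simp only [h1]
    exact hc.adj _

end Block

theorem not_hasDirectedCycleIn_empty (H : Digraph C.W) : ¬ HasDirectedCycleIn H ∅ := by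
  rintro ⟨n, hn, c, -, h⟩
  exact (h 0).1

theorem partialColoring_empty : C.PartialColoring ∅ ∅ :=
  ⟨Set.bijOn_empty _, not_hasDirectedCycleIn_empty _⟩

theorem partialColoring_singleton (x : C.W) : C.PartialColoring {C.proj x} {x} := by
  have := (partialColoring_empty (C := C)).insert_color (x := x) (by simp) (Or.inl (by simp))
  rwa [insert_empty_eq, insert_empty_eq] at this

theorem exists_hole (hd : C.DegreeFeasible) (w : C.V) : ∃ T, C.PartialColoring {w}ᶜ T := by
  obtain ⟨T, -, hT⟩ := exists_extension (Set.mem_univ w) connOn_univ (fun a _ _ => hd a)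
    (T := ∅) (by rw [Set.compl_univ]; exact partialColoring_empty)
  exact ⟨T, hT⟩

theorem exists_hole_mem (hd : C.DegreeFeasible) (hB : ∀ w, C.ConnOn {w}ᶜ) {w : C.V} {x : C.W}
    (hx : C.proj x ≠ w) : ∃ T, C.PartialColoring {w}ᶜ T ∧ x ∈ T := by
  obtain ⟨T, hT, h⟩ := exists_extension (U := {C.proj x}ᶜ) (v := w) (fun h => hx h.symm) (hB _)
    (fun a _ _ => hd a) (T := {x}) (by rw [compl_compl]; exact partialColoring_singleton x)
  exact ⟨T, h, hT rfl⟩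

/-- Degree-feasible uncolorable configurations where `D` is a block and `D` and `H` are
symmetric. -/
structure IsSymmBlock (C : FeasibleConfig.{u, v}) : Prop where
  uncolorable : ¬ Colorable C.X C.H
  degreeFeasible : C.DegreeFeasible
  connOn : ∀ w, C.ConnOn {w}ᶜ
  symmH : ∀ x y, C.H.Adj x y → C.H.Adj y x
  symmD : ∀ a b, C.D.Adj a b → C.D.Adj b a

theorem isSymmBlock_of_forall (hU : ¬ Colorable C.X C.H) (hd : C.DegreeFeasible)
    (hB : ∀ w, C.ConnOn {w}ᶜ)
    (h2 : ∀ (S : Set C.W) (n : ℕ) (c : ZMod n → C.W), C.NearColoring S n c → n = 2) :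
    C.IsSymmBlock := by
  have key : ∀ x t w T, C.PartialColoring {w}ᶜ T → C.proj x = w → t ∈ T → C.H.Adj x t →
      C.H.Adj t x := by
    intro x t w T hT hx ht hxt
    obtain ⟨n, c, hc, hc0⟩ := exists_nearColoring hU hd hT hx
    obtain rfl := h2 _ _ _ hc
    rw [← hc0] at hxt ⊢
    rw [hc.out_unique hU hd (Or.inr ht) hxt]
    exact hc.adj (0 + 1)
  refine ⟨hU, hd, hB, fun x y hxy => ?_, fun a b hab => ?_⟩
  · obtain ⟨T, hT, hy⟩ := exists_hole_mem hd hB (proj_ne hxy).symm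
    exact key x y _ T hT rfl hy hxy
  · obtain ⟨T, hT⟩ := exists_hole hd a
    obtain ⟨t, ht, rfl⟩ := hT.1.surjOn (Set.mem_compl_singleton_iff.2 fun h => by
      rw [h] at hab
      exact C.loopless _ hab : b ∈ {a}ᶜ)
    obtain ⟨x, hx, hxt, -⟩ := hole_out hU hT hd ht hab
    have := adj_proj (key x t _ T hT hx ht hxt)
    rwa [hx] at this

namespace IsSymmBlock

variable (hC : C.IsSymmBlock)
include hC

theorem nbr_iff {a b : C.V} : C.Nbr a b ↔ C.D.Adj a b :=
  ⟨fun h => h.elim id (hC.symmD _ _), Or.inl⟩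

theorem exists_partner {y : C.W} {w : C.V} (h : C.D.Adj w (C.proj y)) :
    ∃ x, C.proj x = w ∧ C.H.Adj x y := by
  obtain ⟨T, hT, hy⟩ := exists_hole_mem hC.degreeFeasible hC.connOn (w := w) (x := y)
    (fun h' => by rw [h'] at h; exact C.loopless _ h)
  obtain ⟨x, hx, hxy, -⟩ := hole_out hC.uncolorable hT hC.degreeFeasible hy h
  exact ⟨x, hx, hxy⟩

/-- Triangles of `D` lift to triangles of `H`. -/
theorem triangle {t x z : C.W} (hxz : C.D.Adj (C.proj x) (C.proj z)) (htx : C.H.Adj t x)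
    (htz : C.H.Adj t z) : C.H.Adj x z := by
  have hU := hC.uncolorable
  have hd := hC.degreeFeasible
  have hne : C.proj x ≠ C.proj z := fun h => by
    rw [h] at hxz
    exact C.loopless _ hxz
  obtain ⟨T, hT, ht⟩ := exists_hole_mem hd hC.connOn (w := C.proj x) (proj_ne htx)
  obtain ⟨t₁, ht₁, htz₁⟩ := hT.1.surjOn (Set.mem_compl_singleton_iff.2 hne.symm)
  obtain ⟨x₁, hx₁, hxt₁, -⟩ := hole_out hU hT hd ht₁ (by rwa [htz₁])
  have htt₁ : t ≠ t₁ := fun h => proj_ne htz (by rw [h, htz₁])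
  have hxx₁ : x₁ ≠ x := by
    rintro rfl
    exact htt₁ (hole_out_unique hU hT hd rfl ht ht₁ (hC.symmH _ _ htx) hxt₁)
  have hT₁ := hT.shift hU hd hx₁ ht₁ (Or.inl hxt₁)
  have ht₁' : t ∈ insert x₁ T \ {t₁} := ⟨Or.inr ht, htt₁⟩
  have hT₂ := hT₁.shift hU hd htz₁.symm ht₁' (Or.inr htz)
  have hx₁' : x₁ ∈ insert z (insert x₁ T \ {t₁}) \ {t} :=
    ⟨Or.inr ⟨Or.inl rfl, fun h => hne (by rw [← hx₁, h, htz₁])⟩,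
      fun h => proj_ne htx (by rw [← hx₁, h])⟩
  obtain ⟨y, hy, hyx₁, -⟩ := hole_out hU hT₂ hd hx₁' (by rw [hx₁]; exact adj_proj htx)
  have hT₃ := hT₂.shift hU hd hy hx₁' (Or.inl hyx₁)
  obtain ⟨s, ⟨hs, hsx₁⟩, hxs⟩ := exists_out hU hT₃ hx₁.symm
  rcases hs with rfl | ⟨rfl | ⟨rfl | hs, -⟩, hst⟩
  · exact absurd (adj_right_unique hyx₁ (hC.symmH _ _ hxs) hx₁) hxx₁
  · exact hxs
  · exact absurd rfl hsx₁
  · exact absurd (hole_out_unique hU hT hd rfl hs ht hxs (hC.symmH _ _ htx)) hst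

theorem ncard_X (a : C.V) : (C.X a).ncard = {b | C.D.Adj a b}.ncard := by
  obtain ⟨T, hT⟩ := exists_hole hC.degreeFeasible a
  exact le_antisymm (ncard_le_outDegree hC.uncolorable hT subset_rfl)
    ((le_max_left _ _).trans (hC.degreeFeasible a))

theorem isK (h : IsCompleteDigraph C.D) : C.IsK := by
  obtain ⟨w⟩ := C.connected.nonempty
  have hm : ∀ a x, C.proj x = w → ∃ y, C.proj y = a ∧ (y = x ∨ C.H.Adj y x) := by
    intro a x hx
    by_cases ha : a = w
    · exact ⟨x, hx.trans ha.symm, Or.inl rfl⟩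
    · obtain ⟨y, hy, hyx⟩ := hC.exists_partner (y := x) (w := a) (by rw [hx]; exact (h a w).2 ha)
      exact ⟨y, hy, Or.inr hyx⟩
  choose! m hmp hm using hm
  have hcard : Nat.card (C.X w) = Nat.card C.V - 1 := by
    rw [Nat.card_coe_set_eq, hC.ncard_X, ← Set.ncard_univ,
      ← Set.ncard_sdiff_singleton_of_mem (Set.mem_univ w)]
    congr 1
    ext b
    simp [h w b, eq_comm]
  let ε := (Finite.equivFinOfCardEq hcard).symm
  have hε : ∀ i, C.proj (ε i : C.W) = w := fun i => C.mem_X.1 (ε i).2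
  have hinj : ∀ a x x', C.proj x = w → C.proj x' = w → m a x = m a x' → x = x' := by
    intro a x x' hx hx' hxx
    rcases hm a x hx with h1 | h1 <;> rcases hm a x' hx' with h2 | h2
    · rw [← h1, ← h2, hxx]
    · rw [← hxx, h1] at h2
      exact absurd (hx.trans hx'.symm) (proj_ne h2)
    · rw [hxx, h2] at h1
      exact absurd (hx'.trans hx.symm) (proj_ne h1)
    · rw [hxx] at h1
      exact adj_right_unique h1 h2 (hx.trans hx'.symm)
  have hsurj : ∀ y, ∃ i, m (C.proj y) (ε i) = y := by
    intro y
    suffices ∃ x, C.proj x = w ∧ m (C.proj y) x = y by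
      obtain ⟨x, hx, hxy⟩ := this
      exact ⟨ε.symm ⟨x, C.mem_X.2 hx⟩, by rw [Equiv.apply_symm_apply]; exact hxy⟩
    by_cases hy : C.proj y = w
    · refine ⟨y, hy, (hm _ y hy).resolve_right fun h' => proj_ne h' (hmp _ _ hy)⟩
    · obtain ⟨x, hx, hxy⟩ := hC.exists_partner (y := y) (w := w) ((h _ _).2 (Ne.symm hy))
      refine ⟨x, hx, ?_⟩
      rcases hm (C.proj y) x hx with h1 | h1
      · exact absurd ((hmp (C.proj y) x hx).symm.trans (by rw [h1, hx])) hy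
      · exact adj_right_unique (hC.symmH _ _ h1) hxy (hmp _ _ hx)
  have hadj : ∀ i a b, a ≠ b → C.H.Adj (m a (ε i)) (m b (ε i)) := by
    intro i a b hab
    have ha := hmp a _ (hε i)
    have hb := hmp b _ (hε i)
    rcases hm a _ (hε i) with h1 | h1 <;> rcases hm b _ (hε i) with h2 | h2
    · exact absurd (by rw [← ha, ← hb, h1, h2]) hab
    · rw [h1]
      exact hC.symmH _ _ h2
    · rw [h2]
      exact h1
    · exact hC.triangle (by rw [ha, hb]; exact (h a b).2 hab) (hC.symmH _ _ h1)
        (hC.symmH _ _ h2)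
  have : Nonempty C.V := ⟨w⟩
  refine ⟨Nat.card C.V, Nat.card_pos, rfl, h, fun a i => m a (ε i), fun a => ⟨?_, ?_, ?_⟩, hadj,
    fun y z hyz => ?_⟩
  · exact fun i _ => C.mem_X.2 (hmp _ _ (hε i))
  · exact fun i _ j _ hij => ε.injective (Subtype.ext (hinj a _ _ (hε i) (hε j) hij))
  · intro y hy
    obtain ⟨i, hi⟩ := hsurj y
    rw [C.mem_X.1 hy] at hi
    exact ⟨i, trivial, hi⟩
  · obtain ⟨i, hi⟩ := hsurj y
    refine ⟨i, C.proj y, C.proj z, hi.symm, ?_⟩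
    have h1 := hadj i _ _ (proj_ne hyz)
    rw [hi] at h1
    exact adj_right_unique hyz h1 (hmp _ _ (hε i)).symm

theorem ncard_X_eq (a b : C.V) : (C.X a).ncard = (C.X b).ncard := by
  have hle : ∀ a b, C.D.Adj a b → (C.X a).ncard ≤ (C.X b).ncard := by
    intro a b hab
    have : ∀ x ∈ C.X a, ∃ y ∈ C.X b, C.H.Adj y x := fun x hx => by
      obtain ⟨y, hy, hyx⟩ := hC.exists_partner (y := x) (w := b)
        (by rw [C.mem_X.1 hx]; exact hC.symmD _ _ hab)
      exact ⟨y, C.mem_X.2 hy, hyx⟩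
    choose! f hf hfx using this
    refine Set.ncard_le_ncard_of_injOn f hf (fun x hx x' hx' h => ?_) (Set.toFinite _)
    have := hfx x hx
    rw [h] at this
    exact adj_right_unique this (hfx x' hx') ((C.mem_X.1 hx).trans (C.mem_X.1 hx').symm)
  by_contra hab
  obtain ⟨c, hc, d, ⟨-, hd⟩, hcd⟩ := connOn_univ (C := C) {c | (C.X a).ncard = (C.X c).ncard}
    (Set.subset_univ _) ⟨a, rfl⟩ ⟨b, trivial, hab⟩
  have hcd' := hC.nbr_iff.1 hcd
  exact hd (Eq.trans hc (le_antisymm (hle _ _ hcd') (hle _ _ (hC.symmD _ _ hcd'))))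

/-- Two nonadjacent neighbors of a vertex separate the graph. -/
theorem not_connOn_pair {a b w : C.V} (hwa : C.D.Adj w a) (hwb : C.D.Adj w b) (hab : a ≠ b)
    (hnab : ¬ C.D.Adj a b) : ¬ C.ConnOn {a, b}ᶜ := by
  intro hconn
  have hne : ∀ {c d}, C.D.Adj c d → c ≠ d := fun h h' => C.loopless _ (h' ▸ h)
  have hX : (C.X w).Nonempty := by
    rw [← Set.ncard_pos (Set.toFinite _), hC.ncard_X]
    exact (Set.ncard_pos (Set.toFinite _)).2 ⟨a, hwa⟩
  obtain ⟨x, hx⟩ := hX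
  rw [C.mem_X] at hx
  obtain ⟨s, rfl, hsx⟩ := hC.exists_partner (y := x) (w := a)
    (by rw [hx]; exact hC.symmD _ _ hwa)
  obtain ⟨t, rfl, htx⟩ := hC.exists_partner (y := x) (w := b)
    (by rw [hx]; exact hC.symmD _ _ hwb)
  have h0 := (partialColoring_singleton t).insert_color (x := s) (by simpa using hab)
    (Or.inl (by
      rintro _ rfl h
      exact hnab (adj_proj h)))
  obtain ⟨T, hT, h⟩ := exists_extension (U := {C.proj s, C.proj t}ᶜ) (v := w)
    (by simp [hne hwa, hne hwb]) hconn (fun a _ _ => hC.degreeFeasible a)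
    (T := {s, t}) (by rw [compl_compl]; exact h0)
  exact hab (congrArg C.proj (hole_out_unique hC.uncolorable h hC.degreeFeasible hx
    (hT (by simp)) (hT (by simp)) (hC.symmH _ _ hsx) (hC.symmH _ _ htx)))

end IsSymmBlock

/-- `{a, b}` separates the vertex set `F` from a nonempty rest. -/
structure IsSeparation (C : FeasibleConfig.{u, v}) (F : Set C.V) (a b : C.V) : Prop where
  nonempty : F.Nonempty
  left : a ∉ F
  right : b ∉ F
  ne : a ≠ b
  rest : ∃ r, r ∉ F ∧ r ≠ a ∧ r ≠ b
  closed : ∀ f ∈ F, ∀ r, r ∉ F → C.Nbr f r → r = a ∨ r = b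

theorem exists_isSeparation {a b : C.V} (hab : a ≠ b) (h : ¬ C.ConnOn {a, b}ᶜ) :
    ∃ F, C.IsSeparation F a b := by
  unfold ConnOn at h
  push Not at h
  obtain ⟨F, hF, hne, ⟨r, hr, hrF⟩, h⟩ := h
  refine ⟨F, hne, fun ha => hF ha (by simp), fun hb => hF hb (by simp), hab,
    ⟨r, hrF, fun h => hr (by simp [h]), fun h => hr (by simp [h])⟩, fun f hf r hr hfr => ?_⟩
  by_contra hcon
  exact h f hf r ⟨fun h' => hcon (by simpa using h'), hr⟩ hfr

theorem IsSeparation.compl {F : Set C.V} {a b : C.V} (h : C.IsSeparation F a b) :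
    C.IsSeparation (F ∪ {a, b})ᶜ a b := by
  obtain ⟨r, hr, hra, hrb⟩ := h.rest
  obtain ⟨f, hf⟩ := h.nonempty
  refine ⟨⟨r, by simp [hr, hra, hrb]⟩, by simp, by simp, h.ne, ⟨f, by simp [hf], ?_, ?_⟩, ?_⟩
  · rintro rfl
    exact h.left hf
  · rintro rfl
    exact h.right hf
  · intro g hg s hs hgs
    by_contra hcon
    have hsF : s ∈ F := by
      by_contra hsF
      exact hs (by simpa [hsF] using hcon)
    have hg' : g ∉ F ∧ ¬ (g = a ∨ g = b) :=
      ⟨fun h => hg (Or.inl h), fun h => hg (Or.inr h)⟩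
    exact hg'.2 (h.closed s hsF g hg'.1 hgs.symm)

/-- In a noncomplete block of minimum degree at least three, there are two nonadjacent vertices
with a common neighbor whose deletion does not disconnect the graph. -/
theorem exists_pair_connOn (hB : ∀ w, C.ConnOn {w}ᶜ) (h3 : ∀ a, 3 ≤ {b | C.Nbr a b}.ncard)
    {p q : C.V} (hpq : p ≠ q) (hnpq : ¬ C.Nbr p q) :
    ∃ w a b, C.Nbr w a ∧ C.Nbr w b ∧ a ≠ b ∧ ¬ C.Nbr a b ∧ C.ConnOn {a, b}ᶜ := by
  by_cases hsep : ∃ F u w, C.IsSeparation F u w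
  · obtain ⟨⟨F, u, w⟩, hF, hmin⟩ := Set.exists_min_image
      {s : Set C.V × C.V × C.V | C.IsSeparation s.1 s.2.1 s.2.2} (fun s => s.1.ncard)
      (Set.toFinite _) (by obtain ⟨F, u, w, h⟩ := hsep; exact ⟨(F, u, w), h⟩)
    replace hF : C.IsSeparation F u w := hF
    replace hmin : ∀ G a b, C.IsSeparation G a b → F.ncard ≤ G.ncard := fun G a b h =>
      hmin (G, a, b) h
    obtain ⟨r₀, hr₀, hr₀u, hr₀w⟩ := hF.rest
    obtain ⟨a, ha, u', ⟨hu', hu'F⟩, hau⟩ := hB w F (fun f hf h => hF.right (h ▸ hf)) hF.nonempty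
      ⟨u, hF.ne, hF.left⟩
    obtain rfl : u = u' := ((hF.closed a ha u' hu'F hau).resolve_right hu').symm
    obtain ⟨u'', hu'', b, ⟨hbw, hbF⟩, hub⟩ := hB w (insert u F)
      (Set.insert_subset hF.ne (fun f hf h => hF.right (h ▸ hf))) ⟨u, Or.inl rfl⟩
      ⟨r₀, hr₀w, fun h => h.elim hr₀u hr₀⟩
    have hbF' : b ∉ F := fun h => hbF (Or.inr h)
    have hbu : b ≠ u := fun h => hbF (Or.inl h)
    obtain rfl : u = u'' := by
      rcases hu'' with h | h
      · exact h.symm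
      · exact absurd (hF.closed _ h _ hbF' hub) (by rintro (h | h); exacts [hbu h, hbw h])
    have hab : a ≠ b := fun h => hbF' (h ▸ ha)
    have hau' : a ≠ u := fun h => hF.left (h ▸ ha)
    have haw : a ≠ w := fun h => hF.right (h ▸ ha)
    have hout : ∀ f, f ∉ F → f ≠ u → f ≠ w → ∀ r ∈ F, ¬ C.Nbr f r := fun f hf h1 h2 r hr h =>
      (hF.closed r hr f hf h.symm).elim h1 h2
    refine ⟨u, a, b, hau.symm, hub, hab, fun h => hout b hbF' hbu hbw a ha h.symm, ?_⟩
    by_contra hconn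
    obtain ⟨G, hG, huG⟩ : ∃ G, C.IsSeparation G a b ∧ u ∉ G := by
      obtain ⟨G, hG⟩ := exists_isSeparation hab hconn
      by_cases huG : u ∈ G
      · exact ⟨_, hG.compl, by simp [huG]⟩
      · exact ⟨G, hG, huG⟩
    have hGu : ∀ f ∈ G, ¬ C.Nbr f u := fun f hf h =>
      (hG.closed f hf u huG h).elim hau'.symm hbu.symm
    by_cases hwG : w ∈ G
    · have h1 : ¬ (G ∩ F).Nonempty := by
        intro hne
        have hs : C.IsSeparation (G ∩ F) a w := by
          refine ⟨hne, fun h => hG.left h.1, fun h => hF.right h.2, haw,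
            ⟨u, fun h => huG h.1, hau'.symm, hF.ne⟩, fun f hf r hr hfr => ?_⟩
          by_cases hrF : r ∈ F
          · refine Or.inl ((hG.closed f hf.1 r (fun h => hr ⟨h, hrF⟩) hfr).resolve_right ?_)
            rintro rfl
            exact hbF' hrF
          · refine Or.inr ((hF.closed f hf.2 r hrF hfr).resolve_left ?_)
            rintro rfl
            exact hGu f hf.1 hfr
        have := Set.ncard_lt_ncard (s := G ∩ F) (t := F)
          ⟨Set.inter_subset_right, fun h => hG.left (h ha).1⟩ (Set.toFinite _)
        have := hmin _ _ _ hs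
        omega
      have h2 : ¬ ((F \ G) \ {a}).Nonempty := by
        intro hne
        have hs : C.IsSeparation ((F \ G) \ {a}) a u := by
          refine ⟨hne, fun h => h.2 rfl, fun h => hF.left h.1.1, hau',
            ⟨w, fun h => h.1.2 hwG, haw.symm, hF.ne.symm⟩, ?_⟩
          rintro f ⟨⟨hfF, hfG⟩, hfa⟩ r hr hfr
          have hfGn : ∀ g ∈ G, ¬ C.Nbr f g := fun g hg h => by
            rcases hG.closed g hg f hfG h.symm with h | h
            · exact hfa h
            · exact hbF' (h ▸ hfF)
          have hrG : r ∉ G := fun h => hfGn r h hfr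
          by_cases hrF : r ∈ F
          · left
            by_contra hra
            exact hr ⟨⟨hrF, hrG⟩, hra⟩
          · refine Or.inr ((hF.closed f hfF r hrF hfr).resolve_right ?_)
            rintro rfl
            exact hrG hwG
        have := Set.ncard_lt_ncard (s := (F \ G) \ {a}) (t := F)
          ⟨fun f hf => hf.1.1, fun h => (h ha).2 rfl⟩ (Set.toFinite _)
        have := hmin _ _ _ hs
        omega
      have hFa : ∀ f ∈ F, f = a := by
        intro f hf
        by_contra hfa
        by_cases hfG : f ∈ G
        · exact h1 ⟨f, hfG, hf⟩
        · exact h2 ⟨f, ⟨hf, hfG⟩, hfa⟩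
      have h4 : {b | C.Nbr a b} ⊆ {u, w} := fun c (hc : C.Nbr a c) => by
        have hcF : c ∉ F := fun h => hc.ne (hFa c h).symm
        simpa using hF.closed a ha c hcF hc
      have := (Set.ncard_le_ncard h4 (Set.toFinite _)).trans (Set.ncard_insert_le _ _)
      have := h3 a
      rw [Set.ncard_singleton] at *
      omega
    · obtain ⟨g, hg⟩ := hG.nonempty
      by_cases hgF : g ∈ F
      · obtain ⟨f, ⟨hfG, hfF⟩, r, ⟨hra, hr⟩, hfr⟩ := hB a (G ∩ F)
          (fun f hf h => hG.left (h ▸ hf.1)) ⟨g, hg, hgF⟩ ⟨u, hau'.symm, fun h => huG h.1⟩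
        have hrG : r ∉ G ∨ r ∉ F := by
          by_contra! h
          exact hr h
        have h5 : r ∉ G → r = b := fun h => (hG.closed f hfG r h hfr).resolve_left hra
        have hrF : r ∉ F := fun h => by
          have := h5 (hrG.resolve_right (fun h' => h' h))
          exact hbF' (this ▸ h)
        rcases hF.closed f hfF r hrF hfr with rfl | rfl
        · exact hGu f hfG hfr
        · exact hbw (h5 hwG).symm
      · obtain ⟨f, ⟨hfG, hfF⟩, r, ⟨hrb, hr⟩, hfr⟩ := hB b (G \ F)
          (fun f hf h => hG.right (h ▸ hf.1)) ⟨g, hg, hgF⟩ ⟨u, hbu.symm, fun h => huG h.1⟩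
        have hfn := hout f hfF (fun h => huG (h ▸ hfG)) (fun h => hwG (h ▸ hfG))
        have hrF : r ∉ F := fun h => hfn r h hfr
        rcases hG.closed f hfG r (fun h => hr ⟨h, hrF⟩) hfr with rfl | rfl
        · exact hrF ha
        · exact hrb rfl
  · obtain ⟨c, hc, d, ⟨-, hd⟩, hcd⟩ := connOn_univ (C := C) {c | c = p ∨ C.Nbr p c}
      (Set.subset_univ _) ⟨p, Or.inl rfl⟩ ⟨q, trivial, fun h => h.elim hpq.symm hnpq⟩
    have hd1 : d ≠ p := fun h => hd (Or.inl h)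
    have hd2 : ¬ C.Nbr p d := fun h => hd (Or.inr h)
    rcases hc with rfl | hc
    · exact absurd hcd hd2
    · refine ⟨c, p, d, hc.symm, hcd, hd1.symm, hd2, ?_⟩
      by_contra h
      obtain ⟨F, hF⟩ := exists_isSeparation hd1.symm h
      exact hsep ⟨F, _, _, hF⟩

theorem IsSymmBlock.ncard_nbr_lt (hC : C.IsSymmBlock) {p q : C.V} (hpq : p ≠ q)
    (hnpq : ¬ C.D.Adj p q) (a : C.V) : {b | C.D.Adj a b}.ncard < 3 := by
  by_contra! h
  obtain ⟨w, a, b, hwa, hwb, hab, hnab, hconn⟩ := exists_pair_connOn hC.connOn (fun b => by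
    simp_rw [hC.nbr_iff]
    rwa [← hC.ncard_X, hC.ncard_X_eq b a, hC.ncard_X]) hpq (by rwa [hC.nbr_iff])
  rw [hC.nbr_iff] at hwa hwb hnab
  exact hC.not_connOn_pair hwa hwb hab hnab hconn

end FeasibleConfig

end DPColoring

namespace DPColoring

section CyclicSums

variable {n : ℕ} [NeZero n]

theorem zmod_val_add_one (i : ZMod n) :
    (i.val + 1 < n ∧ (i + 1).val = i.val + 1) ∨ (i.val + 1 = n ∧ i + 1 = 0) := by
  have hi := ZMod.val_lt i
  have h1 : ((i.val + 1 : ℕ) : ZMod n) = i + 1 := by simp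
  rcases Nat.lt_or_ge (i.val + 1) n with h | h
  · refine Or.inl ⟨h, ?_⟩
    rw [← h1, ZMod.val_natCast, Nat.mod_eq_of_lt h]
  · have h2 : i.val + 1 = n := by omega
    exact Or.inr ⟨h2, by rw [← h1, h2, ZMod.natCast_self]⟩

theorem sum_zmod_eq_sum_range {G : Type*} [AddCommGroup G] (g : ZMod n → G) :
    ∑ i, g i = ∑ k ∈ Finset.range n, g k := by
  refine Finset.sum_nbij' (fun i => i.val) (fun k => (k : ZMod n)) ?_ ?_ ?_ ?_ ?_
  · exact fun i _ => Finset.mem_range.2 (ZMod.val_lt i)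
  · exact fun _ _ => Finset.mem_univ _
  · exact fun i _ => ZMod.natCast_zmod_val i
  · exact fun k hk => ZMod.val_cast_of_lt (Finset.mem_range.1 hk)
  · exact fun i _ => by rw [ZMod.natCast_zmod_val]

/-- A function on a cycle with total sum zero is a difference function. -/
theorem exists_forall_succ_eq_add {G : Type*} [AddCommGroup G] {g : ZMod n → G}
    (hg : ∑ i, g i = 0) : ∃ f : ZMod n → G, ∀ i, f (i + 1) = f i + g i := by
  refine ⟨fun i => ∑ k ∈ Finset.range i.val, g k, fun i => ?_⟩
  have h : g i = g (i.val : ZMod n) := by rw [ZMod.natCast_zmod_val]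
  rw [h, ← Finset.sum_range_succ (fun k : ℕ => g k)]
  change ∑ k ∈ Finset.range (i + 1).val, g k = _
  rcases zmod_val_add_one i with ⟨-, h1⟩ | ⟨h1, h2⟩
  · rw [h1]
  · rw [h1, h2, ← sum_zmod_eq_sum_range, hg]
    simp

theorem sum_succ_sub_self {G : Type*} [AddCommGroup G] (f : ZMod n → G) :
    ∑ i, (f (i + 1) - f i) = 0 := by
  rw [Finset.sum_sub_distrib, sub_eq_zero]
  exact Equiv.sum_comp (Equiv.addRight (1 : ZMod n)) f

end CyclicSums

theorem two_ne_zero_zmod {n : ℕ} (hn : 3 ≤ n) (i : ZMod n) : i + 1 + 1 ≠ i := by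
  intro h
  have h6 : ((2 : ℕ) : ZMod n) = 0 := by
    rw [add_assoc, one_add_one_eq_two] at h
    simpa using h
  rw [ZMod.natCast_eq_zero_iff] at h6
  have := Nat.le_of_dvd (by norm_num) h6
  omega

theorem zmod_two_cases (k : ZMod 2) : k = 0 ∨ k = 1 := by
  revert k
  decide

namespace FeasibleConfig

variable {C : FeasibleConfig.{u, v}}

theorem isBidirectedCycle_of_ncard_eq_two (hs : ∀ a b, C.D.Adj a b → C.D.Adj b a)
    (h2 : ∀ a, {b | C.D.Adj a b}.ncard = 2) : ∃ n, 3 ≤ n ∧ IsBidirectedCycle C.D n := by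
  have hother : ∀ a b, C.D.Adj a b →
      ∃ c, c ≠ b ∧ C.D.Adj a c ∧ ∀ d, C.D.Adj a d → d = b ∨ d = c := by
    intro a b hab
    obtain ⟨c, d, hcd, h⟩ := Set.ncard_eq_two.1 (h2 a)
    have hmem : ∀ e, C.D.Adj a e ↔ e = c ∨ e = d := fun e => by
      have : e ∈ {b | C.D.Adj a b} ↔ e ∈ ({c, d} : Set C.V) := by rw [h]
      simpa using this
    rcases (hmem b).1 hab with rfl | rfl
    · exact ⟨d, hcd.symm, (hmem d).2 (Or.inr rfl), fun e he => (hmem e).1 he⟩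
    · exact ⟨c, hcd, (hmem c).2 (Or.inl rfl), fun e he => ((hmem e).1 he).symm⟩
  choose! nx hnx1 hnx2 hnx3 using hother
  obtain ⟨a₀⟩ := C.connected.nonempty
  obtain ⟨b₀, hb₀⟩ : {b | C.D.Adj a₀ b}.Nonempty :=
    (Set.ncard_pos (Set.toFinite _)).1 (by rw [h2]; norm_num)
  let p : ℕ → C.V × C.V := fun k => Nat.rec (a₀, b₀) (fun _ s => (s.2, nx s.2 s.1)) k
  let q : ℕ → C.V := fun k => (p k).1
  have hp : ∀ k, C.D.Adj (p k).1 (p k).2 := by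
    intro k
    induction k with
    | zero => exact hb₀
    | succ k ih => exact hnx2 _ _ (hs _ _ ih)
  have hq1 : ∀ k, C.D.Adj (q k) (q (k + 1)) := hp
  have hq2 : ∀ k, q (k + 2) ≠ q k := fun k => hnx1 _ _ (hs _ _ (hp k))
  have hq3 : ∀ k d, C.D.Adj (q (k + 1)) d → d = q k ∨ d = q (k + 2) := fun k =>
    hnx3 _ _ (hs _ _ (hp k))
  have hne : ∀ {a b}, C.D.Adj a b → a ≠ b := fun h h' => C.loopless _ (h' ▸ h)
  have hex : ∃ j, ∃ i < j, q i = q j := by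
    obtain ⟨i, j, hij, h⟩ : ∃ i j, q i = q j ∧ i ≠ j := by
      have := not_injective_infinite_finite q
      unfold Function.Injective at this
      push Not at this
      exact this
    rcases lt_or_gt_of_ne h with h | h
    · exact ⟨j, i, h, hij⟩
    · exact ⟨i, j, h, hij.symm⟩
  classical
  obtain ⟨n, ⟨i, hi, hin⟩, hmin⟩ : ∃ n, (∃ i < n, q i = q n) ∧
      ∀ m < n, ¬ ∃ i < m, q i = q m := ⟨_, Nat.find_spec hex, fun m hm => Nat.find_min hex hm⟩
  have hinj : ∀ k < n, ∀ l < n, q k = q l → k = l := by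
    intro k hk l hl hkl
    rcases lt_trichotomy k l with h | h | h
    · exact absurd ⟨k, h, hkl⟩ (hmin l hl)
    · exact h
    · exact absurd ⟨l, h, hkl.symm⟩ (hmin k hk)
  have hi0 : i = 0 := by
    by_contra hi0
    obtain ⟨i, rfl⟩ := Nat.exists_eq_succ_of_ne_zero hi0
    obtain ⟨m, rfl⟩ : ∃ m, n = m + 1 := ⟨n - 1, by omega⟩
    have h1 := hs _ _ (hq1 m)
    rw [← hin] at h1
    have h3 : i + 2 ≠ m + 1 := fun h => by
      rw [← h] at hin
      exact hne (hq1 (i + 1)) hin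
    rcases hq3 _ _ h1 with h | h
    · have := hinj m (by omega) i (by omega) h
      omega
    · have := hinj m (by omega) (i + 2) (by omega) h
      subst this
      exact hq2 (i + 1) hin.symm
  subst hi0
  have hn3 : 3 ≤ n := by
    by_contra h
    interval_cases n
    · exact hne (hq1 0) hin
    · exact hq2 0 hin.symm
  have : NeZero n := ⟨by omega⟩
  have hsucc : ∀ i : ZMod n, q (i + 1).val = q (i.val + 1) := by
    intro i
    rcases zmod_val_add_one i with ⟨-, h⟩ | ⟨h, h'⟩
    · rw [h]
    · rw [h, h', ← hin, ZMod.val_zero]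
  have hadj : ∀ i : ZMod n, C.D.Adj (q i.val) (q (i + 1).val) := fun i => by
    rw [hsucc]
    exact hq1 _
  have hadj' : ∀ i : ZMod n, C.D.Adj (q i.val) (q (i - 1).val) := fun i => by
    have := hs _ _ (hadj (i - 1))
    rwa [sub_add_cancel] at this
  have hqinj : Function.Injective fun i : ZMod n => q i.val := fun i j hij =>
    ZMod.val_injective n (hinj _ (ZMod.val_lt i) _ (ZMod.val_lt j) hij)
  have hnbr : ∀ (i : ZMod n) d, C.D.Adj (q i.val) d →
      d = q (i + 1).val ∨ d = q (i - 1).val := by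
    intro i d hd
    have hsub : {q (i + 1).val, q (i - 1).val} ⊆ {b | C.D.Adj (q i.val) b} := by
      rintro _ (rfl | rfl)
      exacts [hadj i, hadj' i]
    have := Set.eq_of_subset_of_ncard_le hsub (by
      rw [h2, Set.ncard_pair]
      intro h
      have := hqinj h
      refine two_ne_zero_zmod hn3 (i - 1) ?_
      rw [sub_add_cancel, this])
    have hd' : d ∈ ({q (i + 1).val, q (i - 1).val} : Set C.V) := by
      rw [this]
      exact hd
    simpa using hd'
  have hsurj : Function.Surjective fun i : ZMod n => q i.val := by
    intro a
    by_contra ha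
    obtain ⟨_, ⟨i, rfl⟩, d, ⟨-, hd⟩, hid⟩ := connOn_univ (C := C)
      (Set.range fun i : ZMod n => q i.val) (Set.subset_univ _) ⟨_, 0, rfl⟩ ⟨a, trivial, ha⟩
    rcases hnbr i d (hid.elim id (hs _ _)) with h | h
    · exact hd ⟨_, h.symm⟩
    · exact hd ⟨_, h.symm⟩
  refine ⟨n, hn3, Equiv.ofBijective _ ⟨hqinj, hsurj⟩, fun i j => ⟨fun h => ?_, ?_⟩⟩
  · rcases hnbr i _ h with h | h
    · exact Or.inl (hqinj h)
    · right
      rw [hqinj h, sub_add_cancel]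
  · rintro (rfl | rfl)
    · exact hadj i
    · exact hs _ _ (hadj j)

/-- `D` is a bidirected cycle and `H` is a twofold cover of it, where the matchings between
consecutive vertices are straight or crossed, as prescribed by `δ`. -/
structure IsTwistedCycle (C : FeasibleConfig.{u, v}) (n : ℕ) (e : ZMod n ≃ C.V)
    (x : C.V → ZMod 2 → C.W) (δ : ZMod n → ZMod 2) : Prop where
  three_le : 3 ≤ n
  adjD : ∀ i j, C.D.Adj (e i) (e j) ↔ (j = i + 1 ∨ i = j + 1)
  labeling : IsLabeling C.X 2 x
  adjH : ∀ i j k l, C.H.Adj (x (e i) k) (x (e j) l) ↔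
    (j = i + 1 ∧ l = k + δ i) ∨ (i = j + 1 ∧ k = l + δ j)

theorem proj_labeling {m : ℕ} {x : C.V → Fin m → C.W} (hx : IsLabeling C.X m x) (a : C.V)
    (k : Fin m) : C.proj (x a k) = a := C.mem_X.1 ((hx a).mapsTo trivial)

theorem labeling_inj {m : ℕ} {x : C.V → Fin m → C.W} (hx : IsLabeling C.X m x) {a b : C.V}
    {k l : Fin m} : x a k = x b l ↔ a = b ∧ k = l := by
  constructor
  · intro h
    have hab : a = b := by rw [← proj_labeling hx a k, h, proj_labeling hx]
    subst hab
    exact ⟨rfl, (hx a).injOn trivial trivial h⟩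
  · rintro ⟨rfl, rfl⟩
    rfl

theorem exists_label {m : ℕ} {x : C.V → Fin m → C.W} (hx : IsLabeling C.X m x) (y : C.W) :
    ∃ k, x (C.proj y) k = y := by
  obtain ⟨k, -, hk⟩ := (hx (C.proj y)).surjOn (C.mem_X.2 rfl)
  exact ⟨k, hk⟩

theorem forall_adj_iff {n : ℕ} {e : ZMod n ≃ C.V} {x : C.V → ZMod 2 → C.W}
    (hx : IsLabeling C.X 2 x) {R : C.W → C.W → Prop}
    {Q : ZMod n → ZMod n → ZMod 2 → ZMod 2 → Prop}
    (hRQ : ∀ i j k l, R (x (e i) k) (x (e j) l) ↔ Q i j k l) :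
    (∀ y z, C.H.Adj y z ↔ R y z) ↔
      ∀ i j k l, C.H.Adj (x (e i) k) (x (e j) l) ↔ Q i j k l := by
  constructor
  · intro h i j k l
    rw [h, hRQ]
  · intro h y z
    obtain ⟨k, hk⟩ := exists_label hx y
    obtain ⟨l, hl⟩ := exists_label hx z
    have h1 := (h (e.symm (C.proj y)) (e.symm (C.proj z)) k l).trans (hRQ _ _ _ _).symm
    simp only [Equiv.apply_symm_apply] at h1
    rw [← hk, ← hl]
    exact h1

theorem straight_iff {n : ℕ} {e : ZMod n ≃ C.V} {x : C.V → ZMod 2 → C.W}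
    (hD : ∀ i j, C.D.Adj (e i) (e j) ↔ (j = i + 1 ∨ i = j + 1))
    (hx : IsLabeling C.X 2 x) (i j : ZMod n) (k l : ZMod 2) :
    (∃ a b m, C.D.Adj a b ∧ x (e i) k = x a m ∧ x (e j) l = x b m) ↔
      ((j = i + 1 ∧ l = k + 0) ∨ (i = j + 1 ∧ k = l + 0)) := by
  have hinj : ∀ a b k l, x a k = x b l ↔ a = b ∧ k = l := fun _ _ _ _ => labeling_inj hx
  simp only [hinj, add_zero]
  constructor
  · rintro ⟨_, _, _, hab, ⟨rfl, rfl⟩, rfl, rfl⟩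
    exact ((hD _ _).1 hab).imp (fun h => ⟨h, rfl⟩) (fun h => ⟨h, rfl⟩)
  · rintro (⟨h, rfl⟩ | ⟨h, rfl⟩)
    · exact ⟨_, _, _, (hD _ _).2 (Or.inl h), ⟨rfl, rfl⟩, rfl, rfl⟩
    · exact ⟨_, _, _, (hD _ _).2 (Or.inr h), ⟨rfl, rfl⟩, rfl, rfl⟩

theorem crossed_iff {n : ℕ} (hn : 3 ≤ n) {e : ZMod n ≃ C.V} {x : C.V → ZMod 2 → C.W}
    (hD : ∀ i j, C.D.Adj (e i) (e j) ↔ (j = i + 1 ∨ i = j + 1))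
    (hx : IsLabeling C.X 2 x) (m i j : ZMod n) (k l : ZMod 2) :
    ((∃ a b r, s(a, b) ≠ s(e m, e (m + 1)) ∧ C.D.Adj a b ∧ x (e i) k = x a r ∧
        x (e j) l = x b r) ∨
        (x (e i) k = x (e m) 0 ∧ x (e j) l = x (e (m + 1)) 1) ∨
        (x (e i) k = x (e m) 1 ∧ x (e j) l = x (e (m + 1)) 0) ∨
        (x (e i) k = x (e (m + 1)) 1 ∧ x (e j) l = x (e m) 0) ∨
        (x (e i) k = x (e (m + 1)) 0 ∧ x (e j) l = x (e m) 1)) ↔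
      ((j = i + 1 ∧ l = k + (Pi.single m 1 : ZMod n → ZMod 2) i) ∨
        (i = j + 1 ∧ k = l + (Pi.single m 1 : ZMod n → ZMod 2) j)) := by
  have hinj : ∀ a b k l, x a k = x b l ↔ a = b ∧ k = l := fun _ _ _ _ => labeling_inj hx
  have h2 := two_ne_zero_zmod hn
  have h1 : ∀ i : ZMod n, i + 1 ≠ i := ne_succ (by omega)
  have h10 : (1 : ZMod 2) + 1 = 0 := by decide
  simp only [hinj, e.injective.eq_iff]
  constructor
  · rintro (⟨_, _, _, hs, hab, ⟨rfl, rfl⟩, rfl, rfl⟩ | ⟨⟨rfl, rfl⟩, rfl, rfl⟩ |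
      ⟨⟨rfl, rfl⟩, rfl, rfl⟩ | ⟨⟨rfl, rfl⟩, rfl, rfl⟩ | ⟨⟨rfl, rfl⟩, rfl, rfl⟩)
    · refine ((hD _ _).1 hab).imp ?_ ?_
      · rintro rfl
        rw [Pi.single_eq_of_ne (by rintro rfl; exact hs rfl)]
        simp
      · rintro rfl
        rw [Pi.single_eq_of_ne (by rintro rfl; exact hs Sym2.eq_swap)]
        simp
    all_goals simp [h1, h10]
  · have key : ∀ (i : ZMod n) (k : ZMod 2), i ≠ m → s(e i, e (i + 1)) ≠ s(e m, e (m + 1)) := by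
      intro i k him h
      rw [Sym2.eq_iff] at h
      simp only [e.injective.eq_iff] at h
      rcases h with h | ⟨h, h'⟩
      · exact him h.1
      · rw [h] at h'
        exact h2 _ h'
    rintro (⟨rfl, rfl⟩ | ⟨rfl, rfl⟩)
    · by_cases him : i = m
      · subst him
        rcases zmod_two_cases k with rfl | rfl <;> simp [h10]
      · rw [Pi.single_eq_of_ne him]
        exact Or.inl ⟨_, _, k, key i k him, (hD _ _).2 (Or.inl rfl), ⟨rfl, rfl⟩, rfl, by simp⟩
    · by_cases him : j = m
      · subst him
        rcases zmod_two_cases l with rfl | rfl <;> simp [h10]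
      · rw [Pi.single_eq_of_ne him]
        exact Or.inl ⟨_, _, l, by rw [Sym2.eq_swap]; exact key j l him,
          (hD _ _).2 (Or.inr rfl), ⟨rfl, by simp⟩, rfl, rfl⟩

namespace IsTwistedCycle

variable {n : ℕ} {e : ZMod n ≃ C.V} {x : C.V → ZMod 2 → C.W} {δ : ZMod n → ZMod 2}

theorem proj_eq (h : C.IsTwistedCycle n e x δ) (a : C.V) (k : ZMod 2) : C.proj (x a k) = a :=
  proj_labeling h.labeling a k

theorem bijOn_range (h : C.IsTwistedCycle n e x δ) (f : ZMod n → ZMod 2) :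
    Set.BijOn C.proj (Set.range fun i => x (e i) (f i)) Set.univ := by
  refine ⟨fun _ _ => trivial, ?_, fun a _ => ⟨_, ⟨e.symm a, rfl⟩, ?_⟩⟩
  · rintro _ ⟨i, rfl⟩ _ ⟨j, rfl⟩ hij
    simp only [h.proj_eq] at hij
    rw [e.injective hij]
  · simp [h.proj_eq]

/-- Relabeling. -/
theorem relabel (h : C.IsTwistedCycle n e x δ) (f : ZMod n → ZMod 2) :
    C.IsTwistedCycle n e (fun a k => x a (k + f (e.symm a)))
      (fun i => δ i + f i - f (i + 1)) := by
  refine ⟨h.three_le, h.adjD, fun a => ?_, fun i j k l => ?_⟩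
  · refine ⟨fun k _ => C.mem_X.2 (h.proj_eq _ _), fun k _ l _ hkl => ?_, fun y hy => ?_⟩
    · exact add_right_cancel (G := ZMod 2) ((labeling_inj h.labeling).1 hkl).2
    · obtain ⟨k, -, hk⟩ := (h.labeling a).surjOn hy
      refine ⟨(show ZMod 2 from k) - f (e.symm a), trivial, ?_⟩
      simp only
      rw [← hk]
      congr 1
      exact sub_add_cancel (show ZMod 2 from k) _
  · simp only [Equiv.symm_apply_apply]
    rw [h.adjH]
    refine or_congr (and_congr_right ?_) (and_congr_right ?_)
    · rintro rfl
      constructor <;> intro h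
      · linear_combination h
      · linear_combination h
    · rintro rfl
      constructor <;> intro h
      · linear_combination h
      · linear_combination h

end IsTwistedCycle

theorem IsSymmBlock.isBC (hC : C.IsSymmBlock) {p q : C.V} (hpq : p ≠ q)
    (hnpq : ¬ C.D.Adj p q) : C.IsOddBC ∨ C.IsEvenBC := by
  have hdeg2 : ∀ a, {b | C.D.Adj a b}.ncard = 2 := by
    obtain ⟨c, hc, d, ⟨-, hd⟩, hcd⟩ := connOn_univ (C := C) {c | c = p ∨ C.D.Adj p c}
      (Set.subset_univ _) ⟨p, Or.inl rfl⟩ ⟨q, trivial, fun h => h.elim hpq.symm hnpq⟩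
    rw [hC.nbr_iff] at hcd
    have hd1 : d ≠ p := fun h => hd (Or.inl h)
    have hd2 : ¬ C.D.Adj p d := fun h => hd (Or.inr h)
    have hpc : C.D.Adj p c := by
      rcases hc with rfl | hc
      · exact absurd hcd hd2
      · exact hc
    have hsub : {p, d} ⊆ {b | C.D.Adj c b} := by
      rintro _ (rfl | rfl)
      exacts [hC.symmD _ _ hpc, hcd]
    have h1 := Set.ncard_le_ncard hsub (Set.toFinite _)
    rw [Set.ncard_pair hd1.symm, ← hC.ncard_X] at h1
    intro a
    have h2 := hC.ncard_nbr_lt hpq hnpq a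
    rw [← hC.ncard_X, hC.ncard_X_eq a c] at h2 ⊢
    omega
  obtain ⟨n, hn, e, hD⟩ := isBidirectedCycle_of_ncard_eq_two hC.symmD hdeg2
  have : NeZero n := ⟨by omega⟩
  have hn4 : 4 ≤ n := by
    by_contra h
    obtain rfl : n = 3 := by omega
    refine hnpq ?_
    obtain ⟨i, rfl⟩ := e.surjective p
    obtain ⟨j, rfl⟩ := e.surjective q
    rw [hD]
    have : ∀ i j : ZMod 3, i ≠ j → j = i + 1 ∨ i = j + 1 := by decide
    exact this i j fun h => hpq (by rw [h])
  have hcard : ∀ a, Nat.card (C.X a) = 2 := fun a => by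
    rw [Nat.card_coe_set_eq, hC.ncard_X, hdeg2]
  let x : C.V → ZMod 2 → C.W := fun a k => ((Finite.equivFinOfCardEq (hcard a)).symm k : C.X a)
  have hx : IsLabeling C.X 2 x := fun a => by
    refine ⟨fun k _ => Subtype.coe_prop _, fun k _ l _ hkl => ?_, fun y hy => ?_⟩
    · exact (Finite.equivFinOfCardEq (hcard a)).symm.injective (Subtype.ext hkl)
    · refine ⟨Finite.equivFinOfCardEq (hcard a) ⟨y, hy⟩, trivial, ?_⟩
      simp [x]
  have hproj : ∀ a k, C.proj (x a k) = a := fun a k => proj_labeling hx a k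
  have hpart : ∀ (i : ZMod n) (k : ZMod 2),
      ∃ l : ZMod 2, C.H.Adj (x (e i) k) (x (e (i + 1)) l) := by
    intro i k
    obtain ⟨y, hy, hyx⟩ := hC.exists_partner (y := x (e i) k) (w := e (i + 1))
      (by rw [hproj]; exact (hD _ _).2 (Or.inr rfl))
    obtain ⟨l, hl⟩ := exists_label hx y
    rw [hy] at hl
    exact ⟨l, by rw [hl]; exact hC.symmH _ _ hyx⟩
  choose τ hτ using hpart
  have hτinj : ∀ i, Function.Injective (τ i) := fun i k l hkl => by
    have h1 := hτ i k
    rw [hkl] at h1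
    exact ((labeling_inj hx).1 (adj_left_unique h1 (hτ i l) (by rw [hproj, hproj]))).2
  have hperm : ∀ f : ZMod 2 → ZMod 2, Function.Injective f → ∀ k, f k = k + f 0 := by decide
  have hst : ∀ i k l, C.H.Adj (x (e i) k) (x (e (i + 1)) l) ↔ l = k + τ i 0 := by
    intro i k l
    rw [← hperm _ (hτinj i)]
    constructor
    · intro h
      exact ((labeling_inj hx).1 (adj_right_unique h (hτ i k) (by rw [hproj, hproj]))).2
    · rintro rfl
      exact hτ i k
  have hT : C.IsTwistedCycle n e x (fun i => τ i 0) := by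
    refine ⟨hn, hD, hx, fun i j k l => ⟨fun h => ?_, ?_⟩⟩
    · have h1 := adj_proj h
      rw [hproj, hproj, hD] at h1
      rcases h1 with rfl | rfl
      · exact Or.inl ⟨rfl, (hst _ _ _).1 h⟩
      · exact Or.inr ⟨rfl, (hst _ _ _).1 (hC.symmH _ _ h)⟩
    · rintro (⟨rfl, h⟩ | ⟨rfl, h⟩)
      · exact (hst _ _ _).2 h
      · exact hC.symmH _ _ ((hst _ _ _).2 h)
  have hsum : ∑ i, (1 + τ i 0) = 1 := by
    refine (zmod_two_cases _).resolve_left fun h0 => hC.uncolorable ?_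
    obtain ⟨f, hf⟩ := exists_forall_succ_eq_add h0
    refine colorable_iff.2 ⟨_, hT.bijOn_range f, ?_⟩
    rintro ⟨m, hm, c, hc, h⟩
    have h1 := (h 0).2
    obtain ⟨i, hi⟩ := (h 0).1
    obtain ⟨j, hj⟩ := (h (0 + 1)).1
    rw [← hi, ← hj, hT.adjH] at h1
    have h5 : ∀ a b : ZMod 2, a + (1 + b) ≠ a + b := by decide
    rcases h1 with ⟨rfl, h1⟩ | ⟨rfl, h1⟩
    · rw [hf] at h1
      exact h5 _ _ h1
    · rw [hf] at h1
      exact h5 _ _ h1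
  rw [Finset.sum_add_distrib] at hsum
  simp only [Finset.sum_const, Finset.card_univ, ZMod.card, nsmul_eq_mul, mul_one] at hsum
  rcases Nat.even_or_odd n with hev | hodd
  · right
    rw [(ZMod.natCast_eq_zero_iff_even).2 hev, zero_add] at hsum
    obtain ⟨f, hf⟩ := exists_forall_succ_eq_add (n := n)
      (g := fun i => τ i 0 + (Pi.single 0 1 : ZMod n → ZMod 2) i) (by
        rw [Finset.sum_add_distrib, hsum, Finset.sum_pi_single']
        simp
        decide)
    have h := hT.relabel f
    have hδ : (fun i => τ i 0 + f i - f (i + 1)) = (Pi.single 0 1 : ZMod n → ZMod 2) := by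
      funext i
      rw [hf]
      have : ∀ a b c : ZMod 2, a + b - (b + (a + c)) = c := by decide
      exact this _ _ _
    rw [hδ] at h
    exact ⟨⟨n, hn4, hev, e, hD⟩, e 0, e (0 + 1), (hD _ _).2 (Or.inl rfl), _, h.labeling,
      (forall_adj_iff h.labeling (crossed_iff hn hD h.labeling 0)).2 h.adjH⟩
  · left
    rw [(ZMod.natCast_eq_one_iff_odd).2 hodd] at hsum
    obtain ⟨f, hf⟩ := exists_forall_succ_eq_add (n := n) (g := fun i => τ i 0) (by simpa using hsum)
    have h := hT.relabel f
    have hδ : (fun i => τ i 0 + f i - f (i + 1)) = 0 := by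
      funext i
      rw [hf]
      simp [add_comm]
    rw [hδ] at h
    have hn5 : 5 ≤ n := by
      obtain ⟨m, hm⟩ := hodd
      omega
    exact ⟨⟨n, hn5, hodd, e, hD⟩, _, h.labeling,
      (forall_adj_iff h.labeling (straight_iff hD h.labeling)).2 h.adjH⟩

/-- The classification of blocks. -/
theorem isBlockConfig (hU : ¬ Colorable C.X C.H) (hd : C.DegreeFeasible)
    (hB : ∀ w, C.ConnOn {w}ᶜ) : C.IsK ∨ C.IsC ∨ C.IsOddBC ∨ C.IsEvenBC := by
  by_cases h : ∃ (S : Set C.W) (n : ℕ) (c : ZMod n → C.W), C.NearColoring S n c ∧ n ≠ 2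
  · obtain ⟨S, n, c, hc, hn⟩ := h
    have := hc.two_le
    exact Or.inr (Or.inl (hc.isC hU hd (hc.spanning hU hd hB (by omega))))
  · push Not at h
    have hC := isSymmBlock_of_forall hU hd hB h
    by_cases hK : ∀ a b, a ≠ b → C.D.Adj a b
    · exact Or.inl (hC.isK fun a b => ⟨fun h h' => C.loopless _ (h' ▸ h), hK a b⟩)
    · push Not at hK
      obtain ⟨p, q, hpq, hnpq⟩ := hK
      exact Or.inr (Or.inr (hC.isBC hpq hnpq))

end FeasibleConfig

end DPColoring

namespace DPColoring

theorem hasDirectedCycleIn_image {W W' : Type v} {H : Digraph W} {H' : Digraph W'} {φ : W → W'}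
    (hφ : Function.Injective φ) (h : ∀ x y, H.Adj x y ↔ H'.Adj (φ x) (φ y)) {T : Set W} :
    HasDirectedCycleIn H' (φ '' T) ↔ HasDirectedCycleIn H T := by
  constructor
  · rintro ⟨n, hn, c, hc, hc'⟩
    choose d hd using fun i => (hc' i).1
    refine ⟨n, hn, d, fun i j hij => hc ?_, fun i => ⟨(hd i).1, ?_⟩⟩
    · rw [← (hd i).2, ← (hd j).2, hij]
    · rw [h, (hd i).2, (hd (i + 1)).2]
      exact (hc' i).2
  · rintro ⟨n, hn, c, hc, hc'⟩
    exact ⟨n, hn, φ ∘ c, hφ.comp hc, fun i => ⟨⟨_, (hc' i).1, rfl⟩, (h _ _).1 (hc' i).2⟩⟩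

namespace FeasibleConfig

variable {C : FeasibleConfig.{u, v}}

/-- The configuration induced by a connected vertex set `U` and a set `Y` of colors. -/
def restrict (C : FeasibleConfig.{u, v}) (U : Set C.V) (Y : Set C.W) (hne : U.Nonempty)
    (hU : C.ConnOn U) (hY : ∀ x ∈ Y, C.proj x ∈ U) : FeasibleConfig.{u, v} where
  V := U
  W := Y
  finiteV := inferInstance
  finiteW := inferInstance
  D := ⟨fun a b => C.D.Adj a b⟩
  X := fun a => {x | C.proj x = a}
  H := ⟨fun x y => C.H.Adj x y⟩
  loopless := fun a => C.loopless a
  connected := by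
    have : Nonempty U := hne.to_subtype
    refine ⟨fun a b => ?_⟩
    by_contra hab
    obtain ⟨c, ⟨hc, hac⟩, d, ⟨hd, had⟩, hcd⟩ := hU
      {c | ∃ h : c ∈ U, (Digraph.toSimpleGraphInclusive
        (⟨fun a b => C.D.Adj a b⟩ : Digraph U)).Reachable a ⟨c, h⟩} (fun c hc => hc.1)
      ⟨a, a.2, SimpleGraph.Reachable.refl _⟩ ⟨b, b.2, fun h => hab h.2⟩
    refine had ⟨hd, hac.trans (SimpleGraph.Adj.reachable ⟨fun h => hcd.ne ?_, hcd⟩)⟩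
    exact congrArg Subtype.val h
  cover :=
    { disjoint := fun a b hab => Set.disjoint_left.2 fun x hx hx' =>
        hab (Subtype.ext (Eq.trans (Eq.symm hx) hx'))
      union := by
        ext x
        simp only [Set.mem_iUnion, Set.mem_univ, iff_true]
        exact ⟨⟨C.proj x, hY x x.2⟩, rfl⟩
      independent := fun a x hx y hy hxy => proj_ne hxy (Eq.trans hx (Eq.symm hy))
      matching := by
        rintro a b hab ⟨x, y⟩ ⟨hx, hy, hxy⟩ ⟨x', y'⟩ ⟨hx', hy', hxy'⟩ hne
        have hab' : C.proj x ≠ C.proj y := proj_ne hxy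
        have e1 : C.proj x = C.proj x' := Eq.trans hx (Eq.symm hx')
        have e2 : C.proj y = C.proj y' := Eq.trans hy (Eq.symm hy')
        refine ⟨?_, ?_, ?_, ?_⟩
        · rintro rfl
          exact hne (Prod.ext rfl (Subtype.ext (adj_right_unique hxy hxy' e2)))
        · rintro rfl
          exact hab' e2.symm
        · rintro rfl
          exact hab' e1
        · rintro rfl
          exact hne (Prod.ext (Subtype.ext (adj_left_unique hxy hxy' e1)) rfl)
      arcs := fun x y => ⟨fun h => ⟨⟨C.proj x, hY x x.2⟩, ⟨C.proj y, hY y y.2⟩, adj_proj h,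
        rfl, rfl, h⟩, fun ⟨_, _, _, _, _, h⟩ => h⟩ }

section Restrict

variable {U : Set C.V} {Y : Set C.W} {hne : U.Nonempty} {hU : C.ConnOn U}
  {hY : ∀ x ∈ Y, C.proj x ∈ U}

theorem ncard_eq_of_val {α : Type*} {s : Set α} {t : Set s} {t' : Set α}
    (h : ∀ a : s, a ∈ t ↔ (a : α) ∈ t') : t.ncard = (t' ∩ s).ncard := by
  rw [← Set.ncard_image_of_injective t Subtype.val_injective]
  congr 1
  ext a
  constructor
  · rintro ⟨a, ha, rfl⟩
    exact ⟨(h a).1 ha, a.2⟩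
  · rintro ⟨ha, has⟩
    exact ⟨⟨a, has⟩, (h _).2 ha, rfl⟩

theorem outDegree_restrict (a : U) : outDegree (C.restrict U Y hne hU hY).D a =
    ({b | C.D.Adj a b} ∩ U).ncard := ncard_eq_of_val fun _ => Iff.rfl

theorem inDegree_restrict (a : U) : inDegree (C.restrict U Y hne hU hY).D a =
    ({b | C.D.Adj b a} ∩ U).ncard := ncard_eq_of_val fun _ => Iff.rfl

theorem ncard_X_restrict (a : U) : ((C.restrict U Y hne hU hY).X a).ncard =
    (C.X a ∩ Y).ncard := ncard_eq_of_val fun _ => C.mem_X.symm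

theorem colorable_restrict_iff {H : Digraph C.W} {H' : Digraph Y}
    (hH : ∀ x y : Y, H'.Adj x y ↔ H.Adj x y) :
    Colorable (C.restrict U Y hne hU hY).X H' ↔
      ∃ T ⊆ Y, Set.BijOn C.proj T U ∧ ¬ HasDirectedCycleIn H T := by
  constructor
  · rintro ⟨T, hT, hac⟩
    refine ⟨Subtype.val '' T, by rintro _ ⟨x, -, rfl⟩; exact x.2, ⟨?_, ?_, ?_⟩, ?_⟩
    · rintro _ ⟨x, -, rfl⟩
      exact hY x x.2
    · rintro _ ⟨x, hx, rfl⟩ _ ⟨y, hy, rfl⟩ hxy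
      exact congrArg Subtype.val ((hT ⟨C.proj x, hY x x.2⟩).unique ⟨hx, rfl⟩ ⟨hy, hxy.symm⟩)
    · intro a ha
      obtain ⟨x, ⟨hx, hxa⟩, -⟩ := hT ⟨a, ha⟩
      exact ⟨(show Y from x), ⟨x, hx, rfl⟩, hxa⟩
    · exact fun h => hac ((hasDirectedCycleIn_image Subtype.val_injective hH).1 h)
  · rintro ⟨T, hTY, hT, hac⟩
    refine ⟨Subtype.val ⁻¹' T, fun a => ?_, fun h => hac ?_⟩
    · obtain ⟨x, hx, hxa⟩ := hT.surjOn a.2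
      exact ⟨⟨x, hTY hx⟩, ⟨hx, hxa⟩, fun y hy =>
        Subtype.ext (hT.injOn hy.1 hx (Eq.trans hy.2 hxa.symm))⟩
    · exact ((hasDirectedCycleIn_image Subtype.val_injective hH).2 h).subset
        (Set.image_preimage_subset _ _)

end Restrict

/-- The vertex `w` separates the vertex set of `D` into `A` and `B`, which share only `w`. -/
structure IsCut (C : FeasibleConfig.{u, v}) (A B : Set C.V) (w : C.V) : Prop where
  union : A ∪ B = Set.univ
  inter : A ∩ B = {w}
  sep : ∀ a ∈ A, ∀ b ∈ B, C.Nbr a b → a = w ∨ b = w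

/-- The colors of the part `A`, where at `w` only the colors are kept that do not extend to a
coloring of `A`. -/
def cutColors (C : FeasibleConfig.{u, v}) (A : Set C.V) (w : C.V) : Set C.W :=
  {x | C.proj x ∈ A ∧ (C.proj x = w → ∀ T, C.PartialColoring A T → x ∉ T)}

theorem bijOn_inter_preimage {T : Set C.W} {A : Set C.V} (hT : Set.BijOn C.proj T Set.univ) :
    Set.BijOn C.proj (T ∩ C.proj ⁻¹' A) A := by
  refine ⟨fun x hx => hx.2, hT.injOn.mono Set.inter_subset_left, fun a ha => ?_⟩
  obtain ⟨x, hx, rfl⟩ := hT.surjOn (Set.mem_univ a)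
  exact ⟨x, ⟨hx, ha⟩, rfl⟩

theorem X_inter_cutColors {A : Set C.V} {w a : C.V} (ha : a ∈ A) (haw : a ≠ w) :
    C.X a ∩ C.cutColors A w = C.X a := by
  refine Set.inter_eq_left.2 fun x hx => ?_
  rw [C.mem_X] at hx
  subst hx
  exact ⟨ha, fun h => absurd h haw⟩

namespace IsCut

variable {A B : Set C.V} {w : C.V} (h : C.IsCut A B w)
include h

theorem symm : C.IsCut B A w :=
  ⟨by rw [Set.union_comm, h.union], by rw [Set.inter_comm, h.inter],
    fun a ha b hb hab => (h.sep b hb a ha hab.symm).symm⟩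

theorem mem_left : w ∈ A := by
  have : w ∈ A ∩ B := by rw [h.inter]; rfl
  exact this.1

theorem mem_or (a : C.V) : a ∈ A ∨ a ∈ B := by
  have : a ∈ A ∪ B := by rw [h.union]; trivial
  exact this

theorem eq_of_mem {a : C.V} (ha : a ∈ A) (hb : a ∈ B) : a = w := by
  have : a ∈ A ∩ B := ⟨ha, hb⟩
  rwa [h.inter] at this

theorem mem_of_nbr {a b : C.V} (ha : a ∈ A) (haw : a ≠ w) (hab : C.Nbr a b) : b ∈ A :=
  (h.mem_or b).elim id fun hb => by
    rw [(h.sep a ha b hb hab).resolve_left haw]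
    exact h.mem_left

theorem connOn : C.ConnOn A := by
  intro S hS ⟨s, hs⟩ ⟨r, hrA, hr⟩
  by_cases hw : w ∈ S
  · obtain ⟨b, hb, a, ⟨-, ha⟩, hba⟩ := connOn_univ (C := C) (S ∪ B) (Set.subset_univ _)
      ⟨s, Or.inl hs⟩ ⟨r, trivial, fun h' => h'.elim hr fun h'' => hr (by
        rw [h.eq_of_mem hrA h'']; exact hw)⟩
    have haB : a ∉ B := fun h' => ha (Or.inr h')
    have haA : a ∈ A := (h.mem_or a).resolve_right haB
    refine ⟨b, ?_, a, ⟨haA, fun h' => ha (Or.inl h')⟩, hba⟩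
    rcases hb with hb | hb
    · exact hb
    · rcases h.sep a haA b hb hba.symm with rfl | rfl
      · exact absurd h.symm.mem_left haB
      · exact hw
  · obtain ⟨b, hb, a, ⟨-, ha⟩, hba⟩ := connOn_univ (C := C) S (Set.subset_univ _)
      ⟨s, hs⟩ ⟨r, trivial, hr⟩
    exact ⟨b, hb, a, ⟨h.mem_of_nbr (hS hb) (fun h' => hw (h' ▸ hb)) hba, ha⟩, hba⟩

theorem cycle_side {T T' : Set C.W} (hT : ∀ t ∈ T, C.proj t ∈ A) (hT' : ∀ t ∈ T', C.proj t ∈ B)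
    {x : C.W} (hx : x ∈ T) (hx' : x ∈ T') (hxw : C.proj x = w)
    (hTx : ∀ t ∈ T, C.proj t = w → t = x) (hTx' : ∀ t ∈ T', C.proj t = w → t = x)
    (hc : HasDirectedCycleIn C.H (T ∪ T')) :
    HasDirectedCycleIn C.H T ∨ HasDirectedCycleIn C.H T' := by
  obtain ⟨n, hn, c, hc, hcc⟩ := hc
  have : NeZero n := ⟨by omega⟩
  have hcr : ∀ s ∈ T, s ≠ x → ∀ t ∈ T ∪ T', t ≠ x → C.Nbr (C.proj s) (C.proj t) → t ∈ T := by
    rintro s hs hsx t (ht | ht) htx hst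
    · exact ht
    · rcases h.sep _ (hT s hs) _ (hT' t ht) hst with h1 | h1
      · exact absurd (hTx s hs h1) hsx
      · exact absurd (hTx' t ht h1) htx
  have hn1 : ∀ i, C.Nbr (C.proj (c i)) (C.proj (c (i + 1))) := fun i => Or.inl (adj_proj (hcc i).2)
  have hn2 : ∀ i, C.Nbr (C.proj (c i)) (C.proj (c (i - 1))) := fun i => by
    have := (hn1 (i - 1)).symm
    rwa [sub_add_cancel] at this
  have fin : ∀ S, (∀ i, c i ∈ S) → HasDirectedCycleIn C.H S := fun S hS =>
    ⟨n, hn, c, hc, fun i => ⟨hS i, (hcc i).2⟩⟩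
  by_cases hxc : x ∈ Set.range c
  · obtain ⟨m, rfl⟩ := hxc
    by_cases hJ : ∃ i, i ≠ m ∧ c i ∈ T
    · left
      obtain ⟨i, hi⟩ := hJ
      have := fun j (hj : j ≠ m) => forall_ne_mem_of_closed (J := {i | i ≠ m ∧ c i ∈ T}) (m := m)
        (fun h => h.1 rfl)
        (fun i hi him => ⟨him, hcr _ hi.2 (fun h => hi.1 (hc h)) _ (hcc _).1
          (fun h => him (hc h)) (hn1 i)⟩)
        (fun i hi him => ⟨him, hcr _ hi.2 (fun h => hi.1 (hc h)) _ (hcc _).1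
          (fun h => him (hc h)) (hn2 i)⟩) hi hj
      refine fin _ fun j => ?_
      by_cases hj : j = m
      · rw [hj]; exact hx
      · exact (this j hj).2
    · right
      push Not at hJ
      refine fin _ fun j => ?_
      by_cases hj : j = m
      · rw [hj]; exact hx'
      · exact (hcc j).1.resolve_left (hJ j hj)
  · have hne : ∀ i, c i ≠ x := fun i hi => hxc ⟨i, hi⟩
    by_cases hJ : ∃ i, c i ∈ T
    · left
      obtain ⟨i, hi⟩ := hJ
      exact fin _ (forall_mem_of_closed_succ (J := {i | c i ∈ T}) (fun i hi =>
        hcr _ hi (hne _) _ (hcc _).1 (hne _) (hn1 i)) hi)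
    · right
      push Not at hJ
      exact fin _ fun j => (hcc j).1.resolve_left (hJ j)

theorem partialColoring_union {T T' : Set C.W} (hT : C.PartialColoring A T)
    (hT' : C.PartialColoring B T') {x : C.W} (hx : x ∈ T) (hx' : x ∈ T')
    (hxw : C.proj x = w) : C.PartialColoring Set.univ (T ∪ T') := by
  have hTx : ∀ t ∈ T, C.proj t = w → t = x := fun t ht htw =>
    hT.1.injOn ht hx (htw.trans hxw.symm)
  have hTx' : ∀ t ∈ T', C.proj t = w → t = x := fun t ht htw =>
    hT'.1.injOn ht hx' (htw.trans hxw.symm)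
  have hcross : ∀ s ∈ T, ∀ t ∈ T', C.proj s = C.proj t → s = t := by
    intro s hs t ht hst
    have h1 := h.eq_of_mem (hT.1.mapsTo hs) (hst ▸ hT'.1.mapsTo ht)
    rw [hTx s hs h1, hTx' t ht (hst ▸ h1)]
  refine ⟨⟨fun _ _ => trivial, ?_, fun a _ => ?_⟩, fun hc => ?_⟩
  · rintro s (hs | hs) t (ht | ht) hst
    · exact hT.1.injOn hs ht hst
    · exact hcross s hs t ht hst
    · exact (hcross t ht s hs hst.symm).symm
    · exact hT'.1.injOn hs ht hst
  · rcases h.mem_or a with ha | ha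
    · obtain ⟨t, ht, hta⟩ := hT.1.surjOn ha
      exact ⟨t, Or.inl ht, hta⟩
    · obtain ⟨t, ht, hta⟩ := hT'.1.surjOn ha
      exact ⟨t, Or.inr ht, hta⟩
  · exact (h.cycle_side hT.1.mapsTo hT'.1.mapsTo hx hx' hxw hTx hTx' hc).elim hT.2 hT'.2

/-- The part `A` of a configuration with cut vertex `w`. -/
noncomputable def part : FeasibleConfig.{u, v} :=
  C.restrict A (C.cutColors A w) ⟨w, h.mem_left⟩ h.connOn fun _ hx => hx.1

theorem not_colorable_part : ¬ Colorable h.part.X h.part.H := by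
  rintro hcol
  obtain ⟨T, hTY, hT⟩ := (colorable_restrict_iff (H := C.H) fun _ _ => Iff.rfl).1 hcol
  obtain ⟨x, hx, hxw⟩ := hT.1.surjOn h.mem_left
  exact (hTY hx).2 hxw T hT hx

theorem degreeFeasible_part_of_ne (hd : C.DegreeFeasible) (a : A) (haw : (a : C.V) ≠ w) :
    max (outDegree h.part.D a) (inDegree h.part.D a) ≤ (h.part.X a).ncard := by
  have h1 : (h.part.X a).ncard = (C.X a).ncard := by
    rw [← X_inter_cutColors a.2 haw]
    exact ncard_X_restrict a
  rw [h1]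
  refine le_trans (max_le_max ?_ ?_) (hd a)
  · exact (outDegree_restrict a).trans_le (Set.ncard_le_ncard Set.inter_subset_left)
  · exact (inDegree_restrict a).trans_le (Set.ncard_le_ncard Set.inter_subset_left)

theorem ncard_cutColors_le (hd : C.DegreeFeasible) :
    (C.X w ∩ C.cutColors A w).ncard ≤ ({b | C.D.Adj w b} ∩ A).ncard ∧
      (C.X w ∩ C.cutColors A w).ncard ≤ ({b | C.D.Adj b w} ∩ A).ncard := by
  let w' : h.part.V := (⟨w, h.mem_left⟩ : A)
  obtain ⟨T, -, hT⟩ := exists_extension (C := h.part) (Set.mem_univ w') connOn_univ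
    (fun a _ ha => h.degreeFeasible_part_of_ne hd a fun h' => ha (Subtype.ext h'))
    (T := ∅) (by rw [Set.compl_univ]; exact partialColoring_empty)
  have h1 := ncard_le_outDegree h.not_colorable_part hT subset_rfl
  have h2 := ncard_le_inDegree h.not_colorable_part hT subset_rfl
  have e1 : (h.part.X w').ncard = _ := ncard_X_restrict (⟨w, h.mem_left⟩ : A)
  have e2 : {b | h.part.D.Adj w' b}.ncard = _ := outDegree_restrict (⟨w, h.mem_left⟩ : A)
  have e3 : {b | h.part.D.Adj b w'}.ncard = _ := inDegree_restrict (⟨w, h.mem_left⟩ : A)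
  rw [e1] at h1 h2
  rw [e2] at h1
  rw [e3] at h2
  exact ⟨h1, h2⟩

theorem ncard_inter_add {N : Set C.V} (hN : w ∉ N) :
    (N ∩ A).ncard + (N ∩ B).ncard = N.ncard := by
  rw [← Set.ncard_union_eq]
  · rw [← Set.inter_union_distrib_left, h.union, Set.inter_univ]
  · exact Set.disjoint_left.2 fun x hx hx' => hN (h.eq_of_mem hx.2 hx'.2 ▸ hx.1)

variable (hU : ¬ Colorable C.X C.H)
include hU

theorem cutColors_union : C.cutColors A w ∪ C.cutColors B w = Set.univ := by
  refine Set.eq_univ_of_forall fun x => ?_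
  by_cases hxw : C.proj x = w
  · by_contra hcon
    have h1 : ∃ T, C.PartialColoring A T ∧ x ∈ T := by
      by_contra! h1
      exact hcon (Or.inl ⟨hxw ▸ h.mem_left, fun _ => h1⟩)
    have h2 : ∃ T, C.PartialColoring B T ∧ x ∈ T := by
      by_contra! h2
      exact hcon (Or.inr ⟨hxw ▸ h.symm.mem_left, fun _ => h2⟩)
    obtain ⟨T, hT, hx⟩ := h1
    obtain ⟨T', hT', hx'⟩ := h2
    exact hU (colorable_iff.2 ⟨_, h.partialColoring_union hT hT' hx hx' hxw⟩)
  · rcases h.mem_or (C.proj x) with hx | hx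
    · exact Or.inl ⟨hx, fun h => absurd h hxw⟩
    · exact Or.inr ⟨hx, fun h => absurd h hxw⟩

variable (hd : C.DegreeFeasible)
include hd

theorem cut_counts : C.X w ∩ C.cutColors A w ∩ C.cutColors B w = ∅ ∧
    ({b | C.D.Adj w b} ∩ A).ncard ≤ (C.X w ∩ C.cutColors A w).ncard ∧
      ({b | C.D.Adj b w} ∩ A).ncard ≤ (C.X w ∩ C.cutColors A w).ncard := by
  obtain ⟨a1, a2⟩ := h.ncard_cutColors_le hd
  obtain ⟨b1, b2⟩ := h.symm.ncard_cutColors_le hd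
  have o := h.ncard_inter_add (N := {b | C.D.Adj w b}) (C.loopless w)
  have i := h.ncard_inter_add (N := {b | C.D.Adj b w}) (C.loopless w)
  have d1 : {b | C.D.Adj w b}.ncard ≤ _ := (le_max_left _ _).trans (hd w)
  have d2 : {b | C.D.Adj b w}.ncard ≤ _ := (le_max_right _ _).trans (hd w)
  have key := Set.ncard_union_add_ncard_inter (C.X w ∩ C.cutColors A w)
    (C.X w ∩ C.cutColors B w)
  rw [← Set.inter_union_distrib_left, h.cutColors_union hU, Set.inter_univ] at key
  refine ⟨?_, by omega, by omega⟩
  have h0 : ((C.X w ∩ C.cutColors A w) ∩ (C.X w ∩ C.cutColors B w)).ncard = 0 := by omega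
  rw [Set.ncard_eq_zero] at h0
  refine Set.eq_empty_of_forall_notMem fun x hx => ?_
  have : x ∈ ((C.X w ∩ C.cutColors A w) ∩ (C.X w ∩ C.cutColors B w)) := ⟨hx.1, hx.1.1, hx.2⟩
  rw [h0] at this
  exact this

theorem degreeFeasible_part : h.part.DegreeFeasible := by
  rintro ⟨a, ha⟩
  by_cases haw : a = w
  · subst haw
    obtain ⟨-, h1, h2⟩ := h.cut_counts hU hd
    have e1 : (h.part.X (⟨a, ha⟩ : A)).ncard = _ := ncard_X_restrict (⟨a, ha⟩ : A)
    have e2 : outDegree h.part.D (⟨a, ha⟩ : A) = _ := outDegree_restrict (⟨a, ha⟩ : A)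
    have e3 : inDegree h.part.D (⟨a, ha⟩ : A) = _ := inDegree_restrict (⟨a, ha⟩ : A)
    rw [e1, e2, e3]
    exact max_le h1 h2
  · exact h.degreeFeasible_part_of_ne hd ⟨a, ha⟩ haw

theorem notMem_cutColors {x : C.W} (hx : x ∈ C.cutColors A w) : x ∉ C.cutColors B w := by
  intro hx'
  have : x ∈ C.X w ∩ C.cutColors A w ∩ C.cutColors B w :=
    ⟨⟨C.mem_X.2 (h.eq_of_mem hx.1 hx'.1), hx⟩, hx'⟩
  rw [(h.cut_counts hU hd).1] at this
  exact this

theorem inter_subset_cutColors {T : Set C.W} (hT : Set.BijOn C.proj T Set.univ) {q : C.W}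
    (hq : q ∈ T) (hqw : C.proj q = w) (hqA : q ∈ C.cutColors A w) :
    T ∩ C.proj ⁻¹' A ⊆ C.cutColors A w := by
  rintro t ⟨ht, htA⟩
  have ht' : t ∈ C.cutColors A w ∪ C.cutColors B w := by rw [h.cutColors_union hU]; trivial
  refine ht'.resolve_right fun htB => ?_
  rw [hT.injOn ht hq ((h.eq_of_mem htA htB.1).trans hqw.symm)] at htB
  exact h.notMem_cutColors hU hd hqA htB

theorem arc_mem {x y : C.W} {T : Set C.W} (hT : Set.BijOn C.proj T Set.univ)
    (hac : ¬ HasDirectedCycleIn (deleteArc C.H x y) T) {q : C.W}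
    (hq : q ∈ T) (hqw : C.proj q = w) (hqA : q ∈ C.cutColors A w) :
    x ∈ C.cutColors A w ∧ y ∈ C.cutColors A w := by
  have hsub := h.inter_subset_cutColors hU hd hT hq hqw hqA
  by_contra hcon
  refine hqA.2 hqw _ ⟨bijOn_inter_preimage hT, fun hc => hac ?_⟩ ⟨hq, hqA.1⟩
  refine hc.mono Set.inter_subset_left fun a ha b hb hab => ⟨hab, ?_⟩
  rintro ⟨rfl, rfl⟩
  exact hcon ⟨hsub ha, hsub hb⟩

variable (hM : ∀ x y, C.H.Adj x y → Colorable C.X (deleteArc C.H x y))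
include hM

theorem arc_cutColors {x y : C.W} (hxy : C.H.Adj x y) :
    (x ∈ C.cutColors A w ∧ y ∈ C.cutColors A w) ∨
      (x ∈ C.cutColors B w ∧ y ∈ C.cutColors B w) := by
  obtain ⟨T, hT, hac⟩ := hM x y hxy
  rw [isTransversal_iff] at hT
  obtain ⟨q, hq, hqw⟩ := hT.surjOn (Set.mem_univ w)
  have hq' : q ∈ C.cutColors A w ∪ C.cutColors B w := by rw [h.cutColors_union hU]; trivial
  exact hq'.imp (h.arc_mem hU hd hT hac hq hqw) (h.symm.arc_mem hU hd hT hac hq hqw)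

theorem minimalUncolorable_part : h.part.MinimalUncolorable := by
  refine ⟨h.not_colorable_part, ?_⟩
  rintro ⟨x, hx⟩ ⟨y, hy⟩ hxy
  obtain ⟨T, hT, hac⟩ := hM x y hxy
  rw [isTransversal_iff] at hT
  obtain ⟨q, hq, hqw⟩ := hT.surjOn (Set.mem_univ w)
  have hq' : q ∈ C.cutColors A w ∪ C.cutColors B w := by rw [h.cutColors_union hU]; trivial
  have hqA : q ∈ C.cutColors A w := hq'.resolve_right fun hqB =>
    h.notMem_cutColors hU hd hx (h.symm.arc_mem hU hd hT hac hq hqw hqB).1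
  refine (colorable_restrict_iff (H := deleteArc C.H x y) ?_).2
    ⟨_, h.inter_subset_cutColors hU hd hT hq hqw hqA, bijOn_inter_preimage hT,
      fun hc => hac (hc.subset Set.inter_subset_left)⟩
  intro a b
  exact and_congr Iff.rfl (not_congr (and_congr Subtype.ext_iff Subtype.ext_iff))

theorem isMerging : IsMerging h.part h.symm.part C (⟨w, h.mem_left⟩ : A)
    (⟨w, h.symm.mem_left⟩ : B) w (Function.Embedding.subtype _) (Function.Embedding.subtype _)
    (Function.Embedding.subtype _) (Function.Embedding.subtype _) := by
  have hunion := h.cutColors_union hU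
  have hX : ∀ {A' : Set C.V} (a : A'), Subtype.val '' {x : C.cutColors A' w | C.proj x = a} =
      C.X a ∩ C.cutColors A' w := by
    intro A' a
    ext x
    constructor
    · rintro ⟨x, hx, rfl⟩
      exact ⟨C.mem_X.2 hx, x.2⟩
    · rintro ⟨hx, hx'⟩
      exact ⟨⟨x, hx'⟩, C.mem_X.1 hx, rfl⟩
  refine ⟨rfl, rfl, ?_, ?_, ?_, ?_, ?_, ?_, ?_, ?_, ?_⟩
  · refine Eq.trans (congrArg₂ _ ?_ ?_) h.union <;> exact Subtype.range_val
  · refine Eq.trans (congrArg₂ _ ?_ ?_) h.inter <;> exact Subtype.range_val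
  · intro a b
    constructor
    · intro hab
      have hcase : (a ∈ A ∧ b ∈ A) ∨ (a ∈ B ∧ b ∈ B) := by
        rcases h.mem_or a with ha | ha
        · by_cases haw : a = w
          · subst haw
            exact (h.mem_or b).imp (fun hb => ⟨ha, hb⟩) (fun hb => ⟨h.symm.mem_left, hb⟩)
          · exact Or.inl ⟨ha, h.mem_of_nbr ha haw (Or.inl hab)⟩
        · by_cases haw : a = w
          · subst haw
            exact (h.mem_or b).imp (fun hb => ⟨h.mem_left, hb⟩) (fun hb => ⟨ha, hb⟩)
          · exact Or.inr ⟨ha, h.symm.mem_of_nbr ha haw (Or.inl hab)⟩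
      exact hcase.imp (fun hh => ⟨(⟨a, hh.1⟩ : A), (⟨b, hh.2⟩ : A), hab, rfl, rfl⟩)
        (fun hh => ⟨(⟨a, hh.1⟩ : B), (⟨b, hh.2⟩ : B), hab, rfl, rfl⟩)
    · rintro (⟨a, b, hab, rfl, rfl⟩ | ⟨a, b, hab, rfl, rfl⟩) <;> exact hab
  · refine Eq.trans (congrArg₂ _ ?_ ?_) hunion <;> exact Subtype.range_val
  · rw [Set.disjoint_left]
    rintro _ ⟨x, rfl⟩ ⟨y, hy⟩
    have hy' : y.1 = x.1 := hy
    exact h.notMem_cutColors hU hd x.2 (hy' ▸ y.2)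
  · intro x y
    constructor
    · intro hxy
      exact (h.arc_cutColors hU hd hM hxy).imp
        (fun hh => ⟨(⟨x, hh.1⟩ : C.cutColors A w), (⟨y, hh.2⟩ : C.cutColors A w), hxy, rfl, rfl⟩)
        (fun hh => ⟨(⟨x, hh.1⟩ : C.cutColors B w), (⟨y, hh.2⟩ : C.cutColors B w), hxy, rfl, rfl⟩)
    · rintro (⟨a, b, hab, rfl, rfl⟩ | ⟨a, b, hab, rfl, rfl⟩) <;> exact hab
  · refine Eq.trans ?_ (congrArg₂ _ (hX (⟨w, h.mem_left⟩ : A)).symm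
      (hX (⟨w, h.symm.mem_left⟩ : B)).symm)
    rw [← Set.inter_union_distrib_left, hunion, Set.inter_univ]
  · rintro ⟨a, ha⟩ haw
    exact ((hX (⟨a, ha⟩ : A)).trans
      (X_inter_cutColors ha fun h' => haw (Subtype.ext h'))).symm
  · rintro ⟨a, ha⟩ haw
    exact ((hX (⟨a, ha⟩ : B)).trans
      (X_inter_cutColors ha fun h' => haw (Subtype.ext h'))).symm

end IsCut

theorem exists_isCut {w : C.V} (hw : ¬ C.ConnOn {w}ᶜ) :
    ∃ A B, C.IsCut A B w ∧ A ≠ Set.univ ∧ B ≠ Set.univ := by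
  unfold ConnOn at hw
  push Not at hw
  obtain ⟨S, hS, ⟨s, hs⟩, ⟨r, hrw, hr⟩, hsep⟩ := hw
  have hwS : w ∉ S := fun h => hS h rfl
  refine ⟨insert w S, Sᶜ, ⟨?_, ?_, ?_⟩, fun h => ?_, fun h => ?_⟩
  · rw [Set.insert_union, Set.union_compl_self, Set.insert_eq_of_mem (Set.mem_univ _)]
  · ext a
    constructor
    · rintro ⟨ha | ha, ha'⟩
      · exact ha
      · exact absurd ha ha'
    · rintro rfl
      exact ⟨Or.inl rfl, hwS⟩
  · rintro a (ha | ha) b hb hab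
    · exact Or.inl ha
    · by_contra! hcon
      exact hsep a ha b ⟨hcon.2, hb⟩ hab
  · have : r ∈ insert w S := by rw [h]; trivial
    exact this.elim hrw hr
  · have : s ∈ Sᶜ := by rw [h]; trivial
    exact this hs

theorem constructible_of_minimalUncolorable (C : FeasibleConfig.{u, v}) (hd : C.DegreeFeasible)
    (hC : C.MinimalUncolorable) : C.Constructible := by
  induction hn : Nat.card C.V using Nat.strong_induction_on generalizing C with
  | _ n ih =>
    subst hn
    by_cases hB : ∀ w, C.ConnOn {w}ᶜ
    · rcases isBlockConfig hC.1 hd hB with h | h | h | h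
      · exact .ofK _ h
      · exact .ofC _ h
      · exact .ofOddBC _ h
      · exact .ofEvenBC _ h
    · push Not at hB
      obtain ⟨w, hw⟩ := hB
      obtain ⟨A, B, h, hA, hB⟩ := exists_isCut hw
      have hcard : ∀ S : Set C.V, S ≠ Set.univ → Nat.card S < Nat.card C.V := by
        intro S hS
        rw [Nat.card_coe_set_eq, ← Set.ncard_univ]
        exact Set.ncard_lt_ncard (Set.ssubset_univ_iff.2 hS)
      exact .merge _ _ _ _ _ _ _ _ _ _
        (ih _ (hcard A hA) h.part (h.degreeFeasible_part hC.1 hd)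
          (h.minimalUncolorable_part hC.1 hd hC.2) rfl)
        (ih _ (hcard B hB) h.symm.part (h.symm.degreeFeasible_part hC.1 hd)
          (h.symm.minimalUncolorable_part hC.1 hd hC.2) rfl)
        (h.isMerging hC.1 hd hC.2)

end FeasibleConfig

end DPColoring

namespace DPColoring

theorem hasDirectedCycleIn_of_digon {W : Type v} {H : Digraph W} {T : Set W} {x y : W}
    (hne : x ≠ y) (hx : x ∈ T) (hy : y ∈ T) (hxy : H.Adj x y) (hyx : H.Adj y x) :
    HasDirectedCycleIn H T := by
  refine ⟨2, le_rfl, fun i => if i = 0 then x else y, fun i j hij => ?_, fun i => ?_⟩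
  · rcases zmod_two_cases i with rfl | rfl <;> rcases zmod_two_cases j with rfl | rfl
    · rfl
    · exact absurd (by simpa using hij) hne
    · exact absurd (by simpa using hij) hne.symm
    · rfl
  · rcases zmod_two_cases i with rfl | rfl
    · simpa using ⟨hx, hxy⟩
    · have h : (1 : ZMod 2) + 1 = 0 := by decide
      simpa [h] using ⟨hy, hyx⟩

theorem not_hasDirectedCycleIn_of_arc {W : Type v} {H : Digraph W} {T : Set W} {x y : W}
    (hne : x ≠ y) (h : ∀ p ∈ T, ∀ q ∈ T, H.Adj p q → p = x ∧ q = y) :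
    ¬ HasDirectedCycleIn H T := by
  rintro ⟨n, hn, c, -, hc⟩
  have h1 := h _ (hc 0).1 _ (hc (0 + 1)).1 (hc 0).2
  have h2 := h _ (hc (0 + 1)).1 _ (hc (0 + 1 + 1)).1 (hc (0 + 1)).2
  exact hne (h2.1.symm.trans h1.2)

namespace FeasibleConfig

variable {C : FeasibleConfig.{u, v}}

theorem MinimalUncolorable.exists_hole (hC : C.MinimalUncolorable) {y z : C.W}
    (h : C.H.Adj y z) : ∃ T, C.PartialColoring {C.proj y}ᶜ T := by
  obtain ⟨T, hT, hac⟩ := hC.2 y z h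
  rw [isTransversal_iff] at hT
  refine ⟨_, bijOn_inter_preimage hT, fun hc => hac (hc.mono Set.inter_subset_left ?_)⟩
  rintro a ⟨-, ha⟩ b - hab
  refine ⟨hab, ?_⟩
  rintro ⟨rfl, -⟩
  exact ha rfl

/-- Minimal uncolorable, and colorable off every vertex. -/
def IsCritical (C : FeasibleConfig.{u, v}) : Prop :=
  C.MinimalUncolorable ∧ ∀ w, ∃ T, C.PartialColoring {w}ᶜ T

theorem IsK.isCritical (h : C.IsK) : C.IsCritical := by
  obtain ⟨n, hn, hcard, hD, x, hx, hadj, hadj'⟩ := h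
  have hH : ∀ a b i j, C.H.Adj (x a i) (x b j) ↔ a ≠ b ∧ i = j := by
    intro a b i j
    constructor
    · intro h
      obtain ⟨k, a', b', h1, h2⟩ := hadj' _ _ h
      rw [labeling_inj hx] at h1 h2
      exact ⟨fun hab => proj_ne h (by rw [proj_labeling hx, proj_labeling hx, hab]),
        h1.2.trans h2.2.symm⟩
    · rintro ⟨hab, rfl⟩
      exact hadj i a b hab
  have hmin : C.MinimalUncolorable := by
    constructor
    · rintro ⟨T, hT, hac⟩
      rw [isTransversal_iff] at hT
      have : ∀ a, ∃ k, x a k ∈ T := fun a => by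
        obtain ⟨t, ht, rfl⟩ := hT.surjOn (Set.mem_univ a)
        obtain ⟨k, hk⟩ := exists_label hx t
        exact ⟨k, by rwa [hk]⟩
      choose k hk using this
      have hninj : ¬ Function.Injective k := fun hinj => by
        have := Nat.card_le_card_of_injective k hinj
        rw [hcard, Nat.card_fin] at this
        omega
      unfold Function.Injective at hninj
      push Not at hninj
      obtain ⟨a, b, hab, hne⟩ := hninj
      refine hac (hasDirectedCycleIn_of_digon (fun h => hne ((labeling_inj hx).1 h).1) (hk a)
        (hk b) ((hH _ _ _ _).2 ⟨hne, hab⟩) ((hH _ _ _ _).2 ⟨hne.symm, hab.symm⟩))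
    · intro y z hyz
      obtain ⟨i, a, b, rfl, rfl⟩ := hadj' y z hyz
      have hab := ((hH _ _ _ _).1 hyz).1
      classical
      have hcard' : Nat.card ({b}ᶜ : Set C.V) = n - 1 := by
        rw [Nat.card_coe_set_eq, Set.compl_eq_univ_sdiff,
          Set.ncard_sdiff_singleton_of_mem (Set.mem_univ b), Set.ncard_univ, hcard]
      let f := Finite.equivFinOfCardEq hcard'
      let g : ({b}ᶜ : Set C.V) ≃ Fin (n - 1) := f.trans (Equiv.swap (f ⟨a, hab⟩) i)
      have hga : g ⟨a, hab⟩ = i := by simp [g]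
      let l : C.V → Fin (n - 1) := fun c => if h : c = b then i else g ⟨c, h⟩
      have hlb : l b = i := by simp [l]
      have hl : ∀ c (h : c ≠ b), l c = g ⟨c, h⟩ := fun c h => by simp [l, h]
      refine ⟨Set.range fun c => x c (l c), isTransversal_iff.2 ⟨fun _ _ => trivial, ?_, ?_⟩, ?_⟩
      · rintro _ ⟨c, rfl⟩ _ ⟨d, rfl⟩ hcd
        simp only [proj_labeling hx] at hcd
        rw [hcd]
      · exact fun c _ => ⟨_, ⟨c, rfl⟩, proj_labeling hx c _⟩
      · refine not_hasDirectedCycleIn_of_arc (x := x b i) (y := x a i)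
          (fun h => hab ((labeling_inj hx).1 h).1.symm) ?_
        rintro _ ⟨c, rfl⟩ _ ⟨d, rfl⟩ ⟨hcd, hdel⟩
        simp only at hcd hdel ⊢
        rw [hH] at hcd
        by_cases hc : c = b
        · subst hc
          have hcd2 := hcd.2
          rw [hlb, hl d hcd.1.symm, ← hga] at hcd2
          have hd : a = d := congrArg Subtype.val (g.injective hcd2)
          subst hd
          exact ⟨by rw [hlb], by rw [hl a hab, hga]⟩
        · by_cases hd : d = b
          · subst hd
            rw [hlb, hl c hc, ← hga] at hcd
            have hc' : c = a := congrArg Subtype.val (g.injective hcd.2)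
            subst hc'
            exact absurd ⟨by rw [hl c hab, hga], by rw [hlb]⟩ hdel
          · rw [hl c hc, hl d hd] at hcd
            exact absurd (congrArg Subtype.val (g.injective hcd.2)) hcd.1
  refine ⟨hmin, fun w => ?_⟩
  by_cases hw : ∃ b, b ≠ w
  · obtain ⟨b, hb⟩ := hw
    have hn1 : 1 < n := by
      rw [← hcard]
      have : Nontrivial C.V := ⟨⟨b, w, hb⟩⟩
      exact Finite.one_lt_card
    have := hmin.exists_hole (hadj ⟨0, by omega⟩ w b hb.symm)
    rwa [proj_labeling hx] at this
  · push Not at hw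
    refine ⟨∅, ?_⟩
    have : ({w}ᶜ : Set C.V) = ∅ := Set.eq_empty_of_forall_notMem fun b hb => hb (hw b)
    rw [this]
    exact partialColoring_empty

theorem IsC.isCritical (h : C.IsC) : C.IsCritical := by
  obtain ⟨⟨n, hn, e, hD⟩, x, hX, hH⟩ := h
  have : NeZero n := ⟨by omega⟩
  have hproj : ∀ a, C.proj (x a) = a := fun a => C.mem_X.1 (by rw [hX]; rfl)
  have huniq : ∀ y, x (C.proj y) = y := fun y => by
    have : y ∈ C.X (C.proj y) := C.mem_X.2 rfl
    rw [hX] at this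
    exact this.symm
  have hinj : ∀ a b, x a = x b ↔ a = b := fun a b =>
    ⟨fun h => by rw [← hproj a, h, hproj], fun h => by rw [h]⟩
  have hadj : ∀ i j, C.H.Adj (x (e i)) (x (e j)) ↔ j = i + 1 := by
    intro i j
    rw [hH, ← hD]
    constructor
    · rintro ⟨a, b, hab, ha, hb⟩
      rw [(hinj _ _).1 ha, (hinj _ _).1 hb]
      exact hab
    · exact fun h => ⟨_, _, h, rfl, rfl⟩
  have hrep : ∀ y, ∃ i, x (e i) = y := fun y =>
    ⟨e.symm (C.proj y), by rw [e.apply_symm_apply, huniq]⟩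
  have hmin : C.MinimalUncolorable := by
    constructor
    · rintro ⟨T, hT, hac⟩
      rw [isTransversal_iff] at hT
      refine hac ⟨n, hn, fun i => x (e i), fun i j hij => e.injective ((hinj _ _).1 hij),
        fun i => ⟨?_, (hadj _ _).2 rfl⟩⟩
      obtain ⟨t, ht, hti⟩ := hT.surjOn (Set.mem_univ (e i))
      change x (e i) ∈ T
      rwa [← hti, huniq]
    · intro y z hyz
      refine ⟨Set.univ, isTransversal_iff.2 ⟨fun _ _ => trivial, ?_,
        fun a _ => ⟨x a, trivial, hproj a⟩⟩, ?_⟩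
      · intro y _ z _ h
        rw [← huniq y, h, huniq]
      · rintro ⟨m, hm, c, hc, hcc⟩
        obtain ⟨i, hi⟩ := hrep (c 0)
        have hstep : ∀ i k, x (e i) = c k → x (e (i + 1)) = c (k + 1) := by
          intro i k hik
          obtain ⟨j, hj⟩ := hrep (c (k + 1))
          have := (hcc k).2.1
          rw [← hik, ← hj, hadj] at this
          rw [← this, hj]
        have hall := forall_mem_of_closed_succ (J := {i | ∃ k, x (e i) = c k})
          (fun i ⟨k, hk⟩ => ⟨k + 1, hstep i k hk⟩) ⟨0, hi⟩
        obtain ⟨j, rfl⟩ := hrep y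
        obtain ⟨j', rfl⟩ := hrep z
        rw [hadj] at hyz
        subst hyz
        obtain ⟨k, hk⟩ := hall j
        exact (hcc k).2.2 ⟨hk.symm, (hstep j k hk).symm⟩
  refine ⟨hmin, fun w => ?_⟩
  have := hmin.exists_hole ((hadj (e.symm w) _).2 rfl)
  rwa [hproj, e.apply_symm_apply] at this

theorem IsTwistedCycle.isCritical {n : ℕ} {e : ZMod n ≃ C.V} {x : C.V → ZMod 2 → C.W}
    {δ : ZMod n → ZMod 2} [NeZero n] (h : C.IsTwistedCycle n e x δ) (hδ : ∑ i, (1 + δ i) = 1) :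
    C.IsCritical := by
  have hx := h.labeling
  have hinj : ∀ a b k l, x a k = x b l ↔ a = b ∧ k = l := fun _ _ _ _ => labeling_inj hx
  have h1 : ∀ i : ZMod n, i + 1 ≠ i := ne_succ (by have := h.three_le; omega)
  have hlab : ∀ y, ∃ i k, x (e i) k = y := fun y => by
    obtain ⟨k, hk⟩ := exists_label hx y
    exact ⟨e.symm (C.proj y), k, by rw [e.apply_symm_apply]; exact hk⟩
  have hmin : C.MinimalUncolorable := by
    constructor
    · rintro ⟨T, hT, hac⟩
      rw [isTransversal_iff] at hT
      have : ∀ i, ∃ k, x (e i) k ∈ T := fun i => by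
        obtain ⟨t, ht, hti⟩ := hT.surjOn (Set.mem_univ (e i))
        obtain ⟨k, hk⟩ := exists_label hx t
        exact ⟨k, by rw [← hti, hk]; exact ht⟩
      choose f hf using this
      have hex : ∃ i, f (i + 1) = f i + δ i := by
        by_contra! hne
        have hd : ∀ a b c : ZMod 2, a ≠ b + c → a - b = 1 + c := by decide
        have hs := sum_succ_sub_self f
        rw [Finset.sum_congr rfl fun i _ => hd _ _ _ (hne i), hδ] at hs
        exact one_ne_zero hs
      obtain ⟨i, hi⟩ := hex
      exact hac (hasDirectedCycleIn_of_digon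
        (fun h' => h1 i (e.injective ((hinj _ _ _ _).1 h').1).symm) (hf i) (hf (i + 1))
        ((h.adjH _ _ _ _).2 (Or.inl ⟨rfl, hi⟩)) ((h.adjH _ _ _ _).2 (Or.inr ⟨rfl, hi⟩)))
    · have key : ∀ (m : ZMod n) (k : ZMod 2), ∃ f : ZMod n → ZMod 2, f m = k ∧
          f (m + 1) = k + δ m ∧ ∀ i, i ≠ m → f (i + 1) ≠ f i + δ i := by
        intro m k
        obtain ⟨f, hf⟩ := exists_forall_succ_eq_add (n := n)
          (g := fun i => (1 + δ i) + (Pi.single m 1 : ZMod n → ZMod 2) i) (by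
            rw [Finset.sum_add_distrib, hδ, Finset.sum_pi_single']
            simp
            decide)
        refine ⟨fun i => f i + (k - f m), by simp, ?_, fun i hi => ?_⟩
        · simp only
          rw [hf, Pi.single_eq_same]
          have : ∀ a b c : ZMod 2, a + (1 + b + 1) + (c - a) = c + b := by decide
          exact this _ _ _
        · simp only
          rw [hf, Pi.single_eq_of_ne hi]
          have : ∀ a b c : ZMod 2, a + (1 + b + 0) + c ≠ a + c + b := by decide
          exact this _ _ _
      intro y z hyz
      have hyz' : y ≠ z := fun h' => by
        rw [h'] at hyz
        exact not_adj_self _ hyz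
      obtain ⟨m, f, hend, hf⟩ : ∃ (m : ZMod n) (f : ZMod n → ZMod 2),
          ((y = x (e m) (f m) ∧ z = x (e (m + 1)) (f (m + 1))) ∨
            (z = x (e m) (f m) ∧ y = x (e (m + 1)) (f (m + 1)))) ∧
            ∀ i, i ≠ m → f (i + 1) ≠ f i + δ i := by
        obtain ⟨i, k, rfl⟩ := hlab y
        obtain ⟨j, l, rfl⟩ := hlab z
        rw [h.adjH] at hyz
        rcases hyz with ⟨rfl, rfl⟩ | ⟨rfl, rfl⟩
        · obtain ⟨f, hf1, hf2, hf⟩ := key i k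
          exact ⟨i, f, Or.inl ⟨by rw [hf1], by rw [hf2]⟩, hf⟩
        · obtain ⟨f, hf1, hf2, hf⟩ := key j l
          exact ⟨j, f, Or.inr ⟨by rw [hf1], by rw [hf2]⟩, hf⟩
      refine ⟨_, isTransversal_iff.2 (h.bijOn_range f),
        not_hasDirectedCycleIn_of_arc hyz'.symm ?_⟩
      rintro _ ⟨i, rfl⟩ _ ⟨j, rfl⟩ ⟨hij, hdel⟩
      simp only at hij hdel ⊢
      rw [h.adjH] at hij
      rcases hij with ⟨rfl, hij⟩ | ⟨rfl, hij⟩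
      · obtain rfl : i = m := by
          by_contra him
          exact hf i him hij
        rcases hend with ⟨h2, h3⟩ | ⟨h2, h3⟩
        · exact absurd ⟨h2.symm, h3.symm⟩ hdel
        · exact ⟨h2.symm, h3.symm⟩
      · obtain rfl : j = m := by
          by_contra him
          exact hf j him hij
        rcases hend with ⟨h2, h3⟩ | ⟨h2, h3⟩
        · exact ⟨h3.symm, h2.symm⟩
        · exact absurd ⟨h3.symm, h2.symm⟩ hdel
  refine ⟨hmin, fun w => ?_⟩
  have := hmin.exists_hole ((h.adjH (e.symm w) (e.symm w + 1) 0 (0 + δ (e.symm w))).2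
    (Or.inl ⟨rfl, rfl⟩))
  rwa [h.proj_eq, e.apply_symm_apply] at this

theorem IsOddBC.isCritical (h : C.IsOddBC) : C.IsCritical := by
  obtain ⟨⟨n, hn, hodd, e, hD⟩, x, hx, hH⟩ := h
  have : NeZero n := ⟨by omega⟩
  have hT : C.IsTwistedCycle n e x (fun _ => 0) :=
    ⟨by omega, hD, hx, (forall_adj_iff hx (straight_iff hD hx)).1 hH⟩
  refine hT.isCritical ?_
  simp [(ZMod.natCast_eq_one_iff_odd).2 hodd]

theorem IsEvenBC.isCritical (h : C.IsEvenBC) : C.IsCritical := by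
  obtain ⟨⟨n, hn, hev, e, hD⟩, p, p', hpp', x, hx, hH⟩ := h
  have : NeZero n := ⟨by omega⟩
  obtain ⟨m, hm⟩ : ∃ m, ∀ y z, C.H.Adj y z ↔
        (∃ a b i, s(a, b) ≠ s(e m, e (m + 1)) ∧ C.D.Adj a b ∧ y = x a i ∧ z = x b i) ∨
        (y = x (e m) 0 ∧ z = x (e (m + 1)) 1) ∨ (y = x (e m) 1 ∧ z = x (e (m + 1)) 0) ∨
        (y = x (e (m + 1)) 1 ∧ z = x (e m) 0) ∨ (y = x (e (m + 1)) 0 ∧ z = x (e m) 1) := by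
    obtain ⟨i, rfl⟩ := e.surjective p
    obtain ⟨j, rfl⟩ := e.surjective p'
    rcases (hD _ _).1 hpp' with rfl | rfl
    · exact ⟨i, hH⟩
    · refine ⟨j, fun y z => ?_⟩
      rw [hH, Sym2.eq_swap]
      refine or_congr Iff.rfl ⟨?_, ?_⟩ <;> rintro (h | h | h | h)
      all_goals first
        | exact Or.inl h
        | exact Or.inr (Or.inl h)
        | exact Or.inr (Or.inr (Or.inl h))
        | exact Or.inr (Or.inr (Or.inr h))
  have hT : C.IsTwistedCycle n e x (Pi.single m 1) :=
    ⟨by omega, hD, hx, (forall_adj_iff hx (crossed_iff (by omega) hD hx m)).1 hm⟩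
  refine hT.isCritical ?_
  rw [Finset.sum_add_distrib, Finset.sum_pi_single']
  simp [(ZMod.natCast_eq_zero_iff_even).2 hev]

namespace IsMerging

variable {C₁ C₂ : FeasibleConfig.{u, v}} {v₁ : C₁.V} {v₂ : C₂.V} {w : C.V}
  {f₁ : C₁.V ↪ C.V} {f₂ : C₂.V ↪ C.V} {g₁ : C₁.W ↪ C.W} {g₂ : C₂.W ↪ C.W}
variable (h : IsMerging C₁ C₂ C v₁ v₂ w f₁ f₂ g₁ g₂)
include h

theorem symm : IsMerging C₂ C₁ C v₂ v₁ w f₂ f₁ g₂ g₁ where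
  map_left := h.map_right
  map_right := h.map_left
  verts_union := by rw [Set.union_comm, h.verts_union]
  verts_inter := by rw [Set.inter_comm, h.verts_inter]
  arcs_iff := fun a b => (h.arcs_iff a b).trans or_comm
  colors_union := by rw [Set.union_comm, h.colors_union]
  colors_disjoint := h.colors_disjoint.symm
  color_arcs_iff := fun a b => (h.color_arcs_iff a b).trans or_comm
  fiber_merged := by rw [Set.union_comm, h.fiber_merged]
  fiber_left := h.fiber_right
  fiber_right := h.fiber_left

theorem proj_map (x : C₁.W) : C.proj (g₁ x) = f₁ (C₁.proj x) := by
  rw [← C.mem_X]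
  by_cases hx : C₁.proj x = v₁
  · rw [hx, h.map_left, h.fiber_merged]
    exact Or.inl ⟨x, C₁.mem_X.2 hx, rfl⟩
  · rw [h.fiber_left _ hx]
    exact ⟨x, C₁.mem_X.2 rfl, rfl⟩

theorem exists_color (y : C.W) : (∃ x, g₁ x = y) ∨ ∃ x, g₂ x = y := by
  have : y ∈ Set.range g₁ ∪ Set.range g₂ := by rw [h.colors_union]; trivial
  exact this

theorem exists_vertex (a : C.V) : (∃ b, f₁ b = a) ∨ ∃ b, f₂ b = a := by
  have : a ∈ Set.range f₁ ∪ Set.range f₂ := by rw [h.verts_union]; trivial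
  exact this

theorem map_ne (x : C₁.W) (y : C₂.W) : g₁ x ≠ g₂ y := fun hxy =>
  Set.disjoint_left.1 h.colors_disjoint ⟨x, rfl⟩ ⟨y, hxy.symm⟩

theorem eq_left_of_eq {a : C₁.V} {b : C₂.V} (hab : f₁ a = f₂ b) : a = v₁ := by
  have : f₁ a ∈ Set.range f₁ ∩ Set.range f₂ := ⟨⟨a, rfl⟩, b, hab.symm⟩
  rw [h.verts_inter, Set.mem_singleton_iff, ← h.map_left] at this
  exact f₁.injective this

theorem adj_left_iff (x : C₁.W) (y : C.W) :
    C.H.Adj (g₁ x) y ↔ ∃ y', C₁.H.Adj x y' ∧ y = g₁ y' := by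
  rw [h.color_arcs_iff]
  constructor
  · rintro (⟨a, b, hab, ha, hb⟩ | ⟨a, b, hab, ha, hb⟩)
    · rw [← g₁.injective ha] at hab
      exact ⟨b, hab, hb⟩
    · exact absurd ha (h.map_ne _ _)
  · rintro ⟨y', hy, rfl⟩
    exact Or.inl ⟨x, y', hy, rfl, rfl⟩

theorem adj_map_iff (x y : C₁.W) : C₁.H.Adj x y ↔ C.H.Adj (g₁ x) (g₁ y) := by
  rw [h.adj_left_iff]
  constructor
  · exact fun hxy => ⟨y, hxy, rfl⟩
  · rintro ⟨y', hy, hyy⟩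
    rwa [g₁.injective hyy]

theorem hasDirectedCycleIn_of_mem {T : Set C.W} (hT : Set.BijOn C.proj T Set.univ)
    (h₁ : ¬ Colorable C₁.X C₁.H) {t : C₁.W} (ht : g₁ t ∈ T) (htv : C₁.proj t = v₁) :
    HasDirectedCycleIn C.H T := by
  have hb : Set.BijOn C₁.proj (g₁ ⁻¹' T) Set.univ := by
    refine ⟨fun _ _ => trivial, fun x hx y hy hxy => ?_, fun a _ => ?_⟩
    · exact g₁.injective (hT.injOn hx hy (by rw [h.proj_map, h.proj_map, hxy]))
    · by_cases ha : a = v₁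
      · exact ⟨t, ht, htv.trans ha.symm⟩
      · obtain ⟨s, hs, hsa⟩ := hT.surjOn (Set.mem_univ (f₁ a))
        rcases h.exists_color s with ⟨s, rfl⟩ | ⟨s, rfl⟩
        · rw [h.proj_map] at hsa
          exact ⟨s, hs, f₁.injective hsa⟩
        · rw [h.symm.proj_map] at hsa
          exact absurd (h.eq_left_of_eq hsa.symm) ha
  by_contra hac
  refine h₁ (colorable_iff.2 ⟨_, hb, fun hc => hac ?_⟩)
  exact ((hasDirectedCycleIn_image g₁.injective h.adj_map_iff).2 hc).subset
    (Set.image_preimage_subset _ _)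

theorem not_colorable (h₁ : ¬ Colorable C₁.X C₁.H) (h₂ : ¬ Colorable C₂.X C₂.H) :
    ¬ Colorable C.X C.H := by
  rintro ⟨T, hT, hac⟩
  rw [isTransversal_iff] at hT
  obtain ⟨t, ht, htw⟩ := hT.surjOn (Set.mem_univ w)
  rcases h.exists_color t with ⟨t, rfl⟩ | ⟨t, rfl⟩
  · rw [h.proj_map, ← h.map_left] at htw
    exact hac (h.hasDirectedCycleIn_of_mem hT h₁ ht (f₁.injective htw))
  · rw [h.symm.proj_map, ← h.map_right] at htw
    exact hac (h.symm.hasDirectedCycleIn_of_mem hT h₂ ht (f₂.injective htw))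

theorem bijOn_union {T₁ : Set C₁.W} {T₂ : Set C₂.W} {A₁ : Set C₁.V}
    (h₁ : Set.BijOn C₁.proj T₁ A₁) (h₂ : Set.BijOn C₂.proj T₂ {v₂}ᶜ) :
    Set.BijOn C.proj (g₁ '' T₁ ∪ g₂ '' T₂) (f₁ '' A₁ ∪ f₂ '' {v₂}ᶜ) := by
  have hcross : ∀ x ∈ T₁, ∀ y ∈ T₂, f₁ (C₁.proj x) ≠ f₂ (C₂.proj y) := fun x _ y hy hxy =>
    h₂.mapsTo hy (h.symm.eq_left_of_eq hxy.symm)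
  refine ⟨?_, ?_, ?_⟩
  · rintro _ (⟨x, hx, rfl⟩ | ⟨x, hx, rfl⟩)
    · rw [h.proj_map]
      exact Or.inl ⟨_, h₁.mapsTo hx, rfl⟩
    · rw [h.symm.proj_map]
      exact Or.inr ⟨_, h₂.mapsTo hx, rfl⟩
  · rintro _ (⟨x, hx, rfl⟩ | ⟨x, hx, rfl⟩) _ (⟨y, hy, rfl⟩ | ⟨y, hy, rfl⟩) hxy
    · rw [h.proj_map, h.proj_map] at hxy
      rw [h₁.injOn hx hy (f₁.injective hxy)]
    · rw [h.proj_map, h.symm.proj_map] at hxy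
      exact absurd hxy (hcross x hx y hy)
    · rw [h.proj_map, h.symm.proj_map] at hxy
      exact absurd hxy.symm (hcross y hy x hx)
    · rw [h.symm.proj_map, h.symm.proj_map] at hxy
      rw [h₂.injOn hx hy (f₂.injective hxy)]
  · rintro _ (⟨a, ha, rfl⟩ | ⟨a, ha, rfl⟩)
    · obtain ⟨x, hx, rfl⟩ := h₁.surjOn ha
      exact ⟨_, Or.inl ⟨x, hx, rfl⟩, h.proj_map x⟩
    · obtain ⟨x, hx, rfl⟩ := h₂.surjOn ha
      exact ⟨_, Or.inr ⟨x, hx, rfl⟩, h.symm.proj_map x⟩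

theorem acyclic_union {T₁ : Set C₁.W} {T₂ : Set C₂.W} {H : Digraph C.W} {H₁ : Digraph C₁.W}
    (hle : ∀ x y, H.Adj x y → C.H.Adj x y) (hH₁ : ∀ x y, H₁.Adj x y ↔ H.Adj (g₁ x) (g₁ y))
    (h₁ : ¬ HasDirectedCycleIn H₁ T₁) (h₂ : ¬ HasDirectedCycleIn C₂.H T₂) :
    ¬ HasDirectedCycleIn H (g₁ '' T₁ ∪ g₂ '' T₂) := by
  rintro ⟨n, hn, c, hc, hcc⟩
  have : NeZero n := ⟨by omega⟩
  by_cases hJ : ∃ i, c i ∈ g₁ '' T₁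
  · obtain ⟨i, hi⟩ := hJ
    have hall := forall_mem_of_closed_succ (J := {i | c i ∈ g₁ '' T₁}) (fun i hi => by
      obtain ⟨x, hx, hxi⟩ := id hi
      have h2 := hle _ _ (hcc i).2
      rw [← hxi, h.adj_left_iff] at h2
      obtain ⟨y, -, hy⟩ := h2
      refine (hcc (i + 1)).1.resolve_right ?_
      rintro ⟨z, -, hz⟩
      exact h.map_ne y z (hy.symm.trans hz.symm)) hi
    exact h₁ ((hasDirectedCycleIn_image g₁.injective hH₁).1
      ⟨n, hn, c, hc, fun i => ⟨hall i, (hcc i).2⟩⟩)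
  · push Not at hJ
    exact h₂ ((hasDirectedCycleIn_image g₂.injective h.symm.adj_map_iff).1
      ⟨n, hn, c, hc, fun i => ⟨(hcc i).1.resolve_left (hJ i), hle _ _ (hcc i).2⟩⟩)

theorem colorable_deleteArc (h₁ : C₁.IsCritical) (h₂ : C₂.IsCritical) {x y : C₁.W}
    (hxy : C₁.H.Adj x y) : Colorable C.X (deleteArc C.H (g₁ x) (g₁ y)) := by
  obtain ⟨T₁, hT₁, hac₁⟩ := h₁.1.2 x y hxy
  rw [isTransversal_iff] at hT₁
  obtain ⟨T₂, hT₂, hac₂⟩ := h₂.2 v₂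
  refine ⟨_, isTransversal_iff.2 ?_, h.acyclic_union (fun _ _ h => h.1) ?_ hac₁ hac₂⟩
  · have : (Set.univ : Set C.V) = f₁ '' Set.univ ∪ f₂ '' {v₂}ᶜ := by
      refine (Set.eq_univ_of_forall fun a => ?_).symm
      rcases h.exists_vertex a with ⟨b, rfl⟩ | ⟨b, rfl⟩
      · exact Or.inl ⟨b, trivial, rfl⟩
      · by_cases hb : b = v₂
        · refine Or.inl ⟨v₁, trivial, ?_⟩
          rw [hb, h.map_left, h.map_right]
        · exact Or.inr ⟨b, hb, rfl⟩
    rw [this]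
    exact h.bijOn_union hT₁ hT₂
  · intro a b
    exact and_congr (h.adj_map_iff a b)
      (not_congr (and_congr g₁.injective.eq_iff.symm g₁.injective.eq_iff.symm))

theorem exists_hole (h₁ : C₁.IsCritical) (h₂ : C₂.IsCritical) (a : C₁.V) :
    ∃ T, C.PartialColoring {f₁ a}ᶜ T := by
  obtain ⟨T₁, hT₁, hac₁⟩ := h₁.2 a
  obtain ⟨T₂, hT₂, hac₂⟩ := h₂.2 v₂
  refine ⟨_, ?_, h.acyclic_union (fun _ _ h => h) h.adj_map_iff hac₁ hac₂⟩
  have : ({f₁ a}ᶜ : Set C.V) = f₁ '' {a}ᶜ ∪ f₂ '' {v₂}ᶜ := by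
    ext b
    constructor
    · intro hb
      rcases h.exists_vertex b with ⟨c, rfl⟩ | ⟨c, rfl⟩
      · exact Or.inl ⟨c, fun hc => hb (congrArg f₁ hc), rfl⟩
      · by_cases hc : c = v₂
        · subst hc
          rw [h.map_right, ← h.map_left] at hb ⊢
          exact Or.inl ⟨v₁, fun hc => hb (congrArg f₁ hc), rfl⟩
        · exact Or.inr ⟨c, hc, rfl⟩
    · rintro (⟨c, hc, rfl⟩ | ⟨c, hc, rfl⟩) hb
      · exact hc (f₁.injective hb)
      · exact hc (h.symm.eq_left_of_eq hb)
  rw [this]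
  exact h.bijOn_union hT₁ hT₂

theorem isCritical (h₁ : C₁.IsCritical) (h₂ : C₂.IsCritical) : C.IsCritical := by
  refine ⟨⟨h.not_colorable h₁.1.1 h₂.1.1, fun x y hxy => ?_⟩, fun a => ?_⟩
  · rcases (h.color_arcs_iff x y).1 hxy with ⟨x, y, hxy', rfl, rfl⟩ | ⟨x, y, hxy', rfl, rfl⟩
    · exact h.colorable_deleteArc h₁ h₂ hxy'
    · exact h.symm.colorable_deleteArc h₂ h₁ hxy'
  · rcases h.exists_vertex a with ⟨b, rfl⟩ | ⟨b, rfl⟩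
    · exact h.exists_hole h₁ h₂ b
    · exact h.symm.exists_hole h₂ h₁ b

end IsMerging

theorem Constructible.isCritical (h : C.Constructible) : C.IsCritical := by
  induction h with
  | ofK C h => exact h.isCritical
  | ofC C h => exact h.isCritical
  | ofOddBC C h => exact h.isCritical
  | ofEvenBC C h => exact h.isCritical
  | merge C₁ C₂ C v₁ v₂ w f₁ f₂ g₁ g₂ _ _ h ih₁ ih₂ => exact h.isCritical ih₁ ih₂

end FeasibleConfig

end DPColoring

theorem theorem7 (C : DPColoring.FeasibleConfig.{u, v}) (hC : C.DegreeFeasible) :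
    C.MinimalUncolorable ↔ C.Constructible :=
  ⟨C.constructible_of_minimalUncolorable hC, fun h => h.isCritical.1⟩
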